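/- **Theorem 3.7 (Theorem B(a)).** Let $K$ be an algebraic function field of one variable with exact constant field $\mathbb F_q$, let $\infty$ be a place of $K$ of odd degree $\delta$, and let $A$ be the ring of all elements of $K$ that are integral outside $\infty$. Let $K_\infty$ be the completion of $K$ at $\infty$, with valuation ring $\mathcal O_\infty$, let $C_\infty$ be the completion of an algebraic closure of $K_\infty$, and let $\Omega=C_\infty\setminus K_\infty$, on which $GL_2(K_\infty)$ acts by linear fractional transformations. Put $G=GL_2(A)$. An element $\omega\in\Omega$ is called an *elliptic element* of $G$ if its stabilizer $G_\omega$ contains a non-scalar matrix; the set of these is denoted by $E(G)$. Let $\mathcal T$ be the Bruhat–Tits tree of $GL_2(K_\infty)$. Its vertices are the homothety classes of $\mathcal O_\infty$-lattices $L$ of rank $2$ in $K_\infty\oplus K_\infty$ (row vectors), on which $g\in GL_2(K_\infty)$ acts by $gL=Lg^{-1}$. The points of its geometric realization are the similarity classes of nonarchimedean norms on $K_\infty\oplus K_\infty$, the vertex $[L]$ being the class of the norm $x\mapsto\min\{|a| : a\in K_\infty,\ x\in aL\}$. The building map $\lambda$ sends $\omega\in\Omega$ to the class of the norm $(x,y)\mapsto|x\omega+y|$.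 Then for every vertex $v$ of $\mathcal T$ the stabilizer $G_v$ of $v$ in $G$ is finite, and $$v=\lambda(\omega)\ \text{ for some }\ \omega\in E(G)\quad\Longleftrightarrow\quad q^2-1\ \text{ divides }\ |G_v|.$$ -/

import Mathlib

open scoped NNReal WithZero IntermediateField

noncomputable section

namespace DrinfeldModular

/-! ### Part 1. Trees, half-planes and building maps over a complete nonarchimedean field -/

section LocalField

set_option linter.unusedSectionVars false

variable (k : Type*) [NontriviallyNormedField k] [IsUltrametricDist k]

/-- The valuation ring of a nonarchimedean field. -/
def integers : Subring k where
  carrier := {x | ‖x‖ ≤ 1}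
  mul_mem' {x y} hx hy := by
    have hx' : ‖x‖ ≤ 1 := hx
    have hy' : ‖y‖ ≤ 1 := hy
    show ‖x * y‖ ≤ 1
    rw [norm_mul]
    exact mul_le_one₀ hx' (norm_nonneg _) hy'
  one_mem' := by simp
  add_mem' {x y} hx hy := (IsUltrametricDist.norm_add_le_max x y).trans (max_le hx hy)
  zero_mem' := by simp
  neg_mem' {x} hx := by simpa using hx

variable {k} in
/-- A lattice in `k ⊕ k` : the span, over the valuation ring, of a `k`-basis. -/
def IsLattice (L : Submodule (integers k) (Fin 2 → k)) : Prop :=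
  ∃ b : Module.Basis (Fin 2) k (Fin 2 → k), L = Submodule.span (integers k) (Set.range b)

/-- The lattices of rank 2 in `k ⊕ k`. -/
def PlaneLattice : Type _ := {L : Submodule (integers k) (Fin 2 → k) // IsLattice L}

variable {k}

/-- The operation of a matrix `g` on `k ⊕ k`, written as row vectors: `x ↦ x g⁻¹`. This is the left
action of `GL₂(k)` on row vectors for which the building map is equivariant. -/
def rowAct (g : GL (Fin 2) k) : (Fin 2 → k) ≃ₗ[k] (Fin 2 → k) where
  toFun x := Matrix.vecMul x (g⁻¹ : GL (Fin 2) k).val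
  invFun x := Matrix.vecMul x g.val
  map_add' x y := Matrix.add_vecMul _ _ _
  map_smul' c x := Matrix.smul_vecMul _ _ _
  left_inv x := by
    show Matrix.vecMul (Matrix.vecMul x _) _ = x
    rw [Matrix.vecMul_vecMul, Units.inv_mul, Matrix.vecMul_one]
  right_inv x := by
    show Matrix.vecMul (Matrix.vecMul x _) _ = x
    rw [Matrix.vecMul_vecMul, Units.mul_inv, Matrix.vecMul_one]

theorem rowAct_one (x : Fin 2 → k) : rowAct 1 x = x := by
  simp [rowAct]

theorem rowAct_mul (g h : GL (Fin 2) k) (x : Fin 2 → k) :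
    rowAct (g * h) x = rowAct g (rowAct h x) := by
  show Matrix.vecMul x ((g * h)⁻¹ : GL (Fin 2) k).val
    = Matrix.vecMul (Matrix.vecMul x (h⁻¹ : GL (Fin 2) k).val) (g⁻¹ : GL (Fin 2) k).val
  rw [Matrix.vecMul_vecMul, mul_inv_rev, Units.val_mul]

theorem IsLattice.map {L : Submodule (integers k) (Fin 2 → k)} (hL : IsLattice L)
    (g : GL (Fin 2) k) :
    IsLattice (L.map ((rowAct g).restrictScalars (integers k)).toLinearMap) := by
  obtain ⟨b, rfl⟩ := hL
  refine ⟨b.map (rowAct g), ?_⟩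
  rw [Submodule.map_span, ← Set.range_comp]
  congr 2

theorem PlaneLattice.ext {L M : PlaneLattice k} (h : ∀ x, x ∈ L.1 ↔ x ∈ M.1) : L = M :=
  Subtype.ext (Submodule.ext h)

/-- `GL₂(k)` acts on the lattices, by `g • L = {x g⁻¹ : x ∈ L}`. -/
instance : MulAction (GL (Fin 2) k) (PlaneLattice k) where
  smul g L := ⟨L.1.map ((rowAct g).restrictScalars (integers k)).toLinearMap, L.2.map g⟩
  one_smul L := by
    refine PlaneLattice.ext fun x => ⟨?_, fun hx => ⟨x, hx, rowAct_one x⟩⟩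
    rintro ⟨y, hy, rfl⟩
    have : rowAct 1 y = y := rowAct_one y
    show rowAct 1 y ∈ L.1
    rwa [this]
  mul_smul g h L := by
    refine PlaneLattice.ext fun x => ⟨?_, ?_⟩
    · rintro ⟨y, hy, rfl⟩
      exact ⟨rowAct h y, ⟨y, hy, rfl⟩, (rowAct_mul g h y).symm⟩
    · rintro ⟨_, ⟨y, hy, rfl⟩, rfl⟩
      exact ⟨y, hy, rowAct_mul g h y⟩

theorem PlaneLattice.mem_smul {g : GL (Fin 2) k} {L : PlaneLattice k} {x : Fin 2 → k} :
    x ∈ (g • L).1 ↔ ∃ y ∈ L.1, rowAct g y = x := Iff.rfl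

variable (k) in
/-- Two lattices are homothetic if `M = c L` for some nonzero scalar `c`. -/
def homothety : Setoid (PlaneLattice k) where
  r L M := ∃ c : k, c ≠ 0 ∧ ∀ x, x ∈ L.1 ↔ c • x ∈ M.1
  iseqv :=
    { refl := fun L => ⟨1, one_ne_zero, fun x => by rw [one_smul]⟩
      symm := by
        rintro L M ⟨c, hc, h⟩
        exact ⟨c⁻¹, inv_ne_zero hc, fun x => by rw [h, smul_inv_smul₀ hc]⟩
      trans := by
        rintro L M N ⟨c, hc, h⟩ ⟨d, hd, h'⟩
        exact ⟨d * c, mul_ne_zero hd hc, fun x => by rw [h, h', mul_smul]⟩ }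

variable (k) in
/-- The vertices of the Bruhat–Tits tree of `GL₂(k)` : the homothety classes of lattices. -/
def Vertex : Type _ := Quotient (homothety k)

theorem homothety_smul (g : GL (Fin 2) k) {L M : PlaneLattice k} (h : homothety k L M) :
    homothety k (g • L) (g • M) := by
  obtain ⟨c, hc, h⟩ := h
  refine ⟨c, hc, fun x => ?_⟩
  simp only [PlaneLattice.mem_smul]
  constructor
  · rintro ⟨y, hy, rfl⟩
    exact ⟨c • y, (h y).1 hy, map_smul _ _ _⟩
  · rintro ⟨y, hy, hyx⟩
    refine ⟨c⁻¹ • y, (h _).2 (by rwa [smul_inv_smul₀ hc]), ?_⟩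
    rw [map_smul, hyx, inv_smul_smul₀ hc]

/-- The action of `GL₂(k)` on the vertices of the tree. -/
instance : MulAction (GL (Fin 2) k) (Vertex k) where
  smul g := Quotient.map (fun L => g • L) fun _ _ h => homothety_smul g h
  one_smul := by
    rintro ⟨L⟩
    exact congrArg (Quotient.mk (homothety k)) (one_smul _ L)
  mul_smul g h := by
    rintro ⟨L⟩
    exact congrArg (Quotient.mk (homothety k)) (mul_smul g h L)

variable (k) in
/-- A (nonarchimedean) norm on the vector space `k ⊕ k`. -/
structure PlaneNorm where
  toFun : (Fin 2 → k) → ℝ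
  nonneg : ∀ x, 0 ≤ toFun x
  eq_zero_iff : ∀ x, toFun x = 0 ↔ x = 0
  smul : ∀ (a : k) x, toFun (a • x) = ‖a‖ * toFun x
  add_le_max : ∀ x y, toFun (x + y) ≤ max (toFun x) (toFun y)

variable (k) in
/-- Two norms are similar if they are proportional. -/
def similarity : Setoid (PlaneNorm k) where
  r M N := ∃ c : ℝ, 0 < c ∧ ∀ x, N.toFun x = c * M.toFun x
  iseqv :=
    { refl := fun N => ⟨1, one_pos, fun x => by rw [one_mul]⟩
      symm := by
        rintro M N ⟨c, hc, h⟩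
        exact ⟨c⁻¹, inv_pos.2 hc, fun x => by rw [h, inv_mul_cancel_left₀ hc.ne']⟩
      trans := by
        rintro L M N ⟨c, hc, h⟩ ⟨d, hd, h'⟩
        exact ⟨d * c, mul_pos hd hc, fun x => by rw [h', h, mul_assoc]⟩ }

variable (k) in
/-- The points of the (geometric realization of the) Bruhat–Tits tree of `GL₂(k)`, after Goldman
and Iwahori: the similarity classes of norms on `k ⊕ k`. -/
def TreePoint : Type _ := Quotient (similarity k)

/-- The norm with unit ball the lattice `L` and with values in the values of `k` :
`x ↦ min {‖a‖ : x ∈ a L}`. -/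
def latticeGauge (L : Submodule (integers k) (Fin 2 → k)) (x : Fin 2 → k) : ℝ :=
  sInf {r | ∃ a : k, ∃ y ∈ L, x = a • y ∧ r = ‖a‖}

theorem mem_span_basis_iff (b : Module.Basis (Fin 2) k (Fin 2 → k)) (x : Fin 2 → k) :
    x ∈ Submodule.span (integers k) (Set.range b) ↔ ∀ i, ‖b.repr x i‖ ≤ 1 := by
  rw [Submodule.mem_span_range_iff_exists_fun]
  constructor
  · rintro ⟨c, rfl⟩ i
    have : ∑ j, c j • b j = ∑ j, (c j : k) • b j := rfl
    rw [this, b.repr_sum_self]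
    exact (c i).2
  · intro h
    exact ⟨fun i => ⟨b.repr x i, h i⟩, b.sum_repr x⟩

theorem latticeGauge_eq (b : Module.Basis (Fin 2) k (Fin 2 → k)) (x : Fin 2 → k) :
    latticeGauge (Submodule.span (integers k) (Set.range b)) x
      = max ‖b.repr x 0‖ ‖b.repr x 1‖ := by
  refine IsLeast.csInf_eq ⟨?_, ?_⟩
  · have key : ∀ j, (∀ i, ‖b.repr x i‖ ≤ ‖b.repr x j‖) →
        ∃ a : k, ∃ y ∈ Submodule.span (integers k) (Set.range b),
          x = a • y ∧ ‖b.repr x j‖ = ‖a‖ := by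
      intro j hj
      rcases eq_or_ne (b.repr x j) 0 with h0 | h0
      · have hx : x = 0 := by
          refine b.ext_elem fun i => ?_
          have := hj i
          rw [h0, norm_zero] at this
          simpa using norm_le_zero_iff.1 this
        exact ⟨b.repr x j, 0, Submodule.zero_mem _, by simp [hx], rfl⟩
      · refine ⟨b.repr x j, (b.repr x j)⁻¹ • x, ?_, by rw [smul_inv_smul₀ h0], rfl⟩
        rw [mem_span_basis_iff]
        intro i
        rw [map_smul, Finsupp.smul_apply, smul_eq_mul, norm_mul, norm_inv]
        exact inv_mul_le_one_of_le₀ (hj i) (norm_nonneg _)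
    rcases le_total ‖b.repr x 0‖ ‖b.repr x 1‖ with h | h
    · rw [max_eq_right h]
      exact key 1 (by rw [Fin.forall_fin_two]; exact ⟨h, le_rfl⟩)
    · rw [max_eq_left h]
      exact key 0 (by rw [Fin.forall_fin_two]; exact ⟨le_rfl, h⟩)
  · rintro r ⟨a, y, hy, rfl, rfl⟩
    rw [mem_span_basis_iff] at hy
    have : ∀ i, ‖b.repr (a • y) i‖ ≤ ‖a‖ := fun i => by
      rw [map_smul, Finsupp.smul_apply, smul_eq_mul, norm_mul]
      exact mul_le_of_le_one_right (norm_nonneg _) (hy i)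
    exact max_le (this 0) (this 1)

/-- The norm attached to a lattice. -/
def PlaneLattice.toNorm (L : PlaneLattice k) : PlaneNorm k where
  toFun := latticeGauge L.1
  nonneg x := by
    obtain ⟨b, hb⟩ := L.2
    rw [hb, latticeGauge_eq]
    exact le_max_of_le_left (norm_nonneg _)
  eq_zero_iff x := by
    obtain ⟨b, hb⟩ := L.2
    rw [hb, latticeGauge_eq]
    constructor
    · intro h
      refine b.ext_elem fun i => ?_
      have h0 := (le_max_left ‖b.repr x 0‖ ‖b.repr x 1‖).trans h.le
      have h1 := (le_max_right ‖b.repr x 0‖ ‖b.repr x 1‖).trans h.le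
      fin_cases i
      · simpa using h0
      · simpa using h1
    · rintro rfl
      simp
  smul a x := by
    obtain ⟨b, hb⟩ := L.2
    rw [hb, latticeGauge_eq, latticeGauge_eq, mul_max_of_nonneg _ _ (norm_nonneg a)]
    simp
  add_le_max x y := by
    obtain ⟨b, hb⟩ := L.2
    rw [hb, latticeGauge_eq, latticeGauge_eq, latticeGauge_eq]
    have : ∀ i, ‖b.repr (x + y) i‖ ≤ max ‖b.repr x i‖ ‖b.repr y i‖ := fun i => by
      rw [map_add, Finsupp.add_apply]
      exact IsUltrametricDist.norm_add_le_max _ _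
    refine max_le ((this 0).trans ?_) ((this 1).trans ?_)
    · exact max_le_max (le_max_left _ _) (le_max_left _ _)
    · exact max_le_max (le_max_right _ _) (le_max_right _ _)

/-- A vertex of the tree as a point of the tree: the class of `L` gives the class of the norm
attached to `L`. -/
def Vertex.toPoint : Vertex k → TreePoint k :=
  Quotient.map PlaneLattice.toNorm <| by
    rintro L M ⟨c, hc, h⟩
    refine ⟨‖c‖⁻¹, inv_pos.2 (norm_pos_iff.2 hc), fun x => ?_⟩
    obtain ⟨b, hb⟩ := L.2
    let u : Fin 2 → kˣ := fun _ => Units.mk0 c hc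
    have hM : M.1 = Submodule.span (integers k) (Set.range (b.unitsSMul u)) := by
      ext y
      rw [mem_span_basis_iff]
      have h1 : y ∈ M.1 ↔ c⁻¹ • y ∈ L.1 := by rw [h, smul_inv_smul₀ hc]
      rw [h1, hb, mem_span_basis_iff]
      refine forall_congr' fun i => ?_
      rw [b.repr_unitsSMul]
      simp [u, Units.smul_def]
    show latticeGauge M.1 x = _ * latticeGauge L.1 x
    rw [hM, hb, latticeGauge_eq, latticeGauge_eq, b.repr_unitsSMul, b.repr_unitsSMul,
      mul_max_of_nonneg _ _ (inv_nonneg.2 (norm_nonneg c))]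
    simp [u, Units.smul_def]

section HalfPlane

variable (k) [CompleteSpace k]

/-- An algebraic closure of `k`, with the unique extension of the absolute value of `k`. -/
instance : NormedField (AlgebraicClosure k) := spectralNorm.normedField k (AlgebraicClosure k)

instance : NormedAlgebra k (AlgebraicClosure k) := spectralNorm.normedAlgebra k (AlgebraicClosure k)

/-- The completion of an algebraic closure of `k`. -/
abbrev CompletedClosure : Type _ := UniformSpace.Completion (AlgebraicClosure k)

instance : IsUltrametricDist (CompletedClosure k) := IsUltrametricDist.of_normedAlgebra k

/-- The Drinfeld upper half-plane of `k`. -/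
def HalfPlane : Type _ :=
  {ω : CompletedClosure k // ω ∉ Set.range (algebraMap k (CompletedClosure k))}

variable {k}

theorem HalfPlane.eq_zero (ω : HalfPlane k) {u v : k}
    (h : algebraMap k (CompletedClosure k) u * ω.1 + algebraMap k (CompletedClosure k) v = 0) :
    u = 0 ∧ v = 0 := by
  have hu : u = 0 := by
    by_contra hu
    refine ω.2 ⟨-v / u, ?_⟩
    have hu' : algebraMap k (CompletedClosure k) u ≠ 0 := by simpa using hu
    rw [map_div₀, map_neg, div_eq_iff hu', neg_eq_iff_add_eq_zero, ← h]
    ring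
  refine ⟨hu, ?_⟩
  rw [hu, map_zero, zero_mul, zero_add] at h
  simpa using h

/-- The linear fractional transformation `(a ω + b) / (c ω + d)`. -/
def mobius (g : GL (Fin 2) k) (ω : CompletedClosure k) : CompletedClosure k :=
  (algebraMap k _ (g 0 0) * ω + algebraMap k _ (g 0 1)) /
    (algebraMap k _ (g 1 0) * ω + algebraMap k _ (g 1 1))

theorem denom_ne_zero (g : GL (Fin 2) k) (ω : HalfPlane k) :
    algebraMap k (CompletedClosure k) (g 1 0) * ω.1
      + algebraMap k (CompletedClosure k) (g 1 1) ≠ 0 := by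
  intro h
  obtain ⟨h0, h1⟩ := ω.eq_zero h
  have hdet : g.val.det ≠ 0 := (Matrix.isUnits_det_units g).ne_zero
  exact hdet (by rw [Matrix.det_fin_two, h0, h1]; ring)

theorem mobius_notMem (g : GL (Fin 2) k) (ω : HalfPlane k) :
    mobius g ω.1 ∉ Set.range (algebraMap k (CompletedClosure k)) := by
  rintro ⟨z, hz⟩
  rw [mobius, eq_div_iff (denom_ne_zero g ω)] at hz
  obtain ⟨h0, h1⟩ := ω.eq_zero (u := g 0 0 - z * g 1 0) (v := g 0 1 - z * g 1 1) (by
    simp only [map_sub, map_mul]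
    linear_combination -hz)
  have hdet : g.val.det ≠ 0 := (Matrix.isUnits_det_units g).ne_zero
  refine hdet ?_
  rw [Matrix.det_fin_two]
  linear_combination (g 1 1) * h0 - (g 1 0) * h1

/-- The action of `GL₂(k)` on the half-plane by linear fractional transformations. -/
instance : MulAction (GL (Fin 2) k) (HalfPlane k) where
  smul g ω := ⟨mobius g ω.1, mobius_notMem g ω⟩
  one_smul ω := by
    refine Subtype.ext ?_
    show mobius 1 ω.1 = ω.1
    simp [mobius]
  mul_smul g h ω := by
    refine Subtype.ext ?_
    show mobius (g * h) ω.1 = mobius g (mobius h ω.1)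
    have h1 := denom_ne_zero (g * h) ω
    have h2 := denom_ne_zero h ω
    have h3 := denom_ne_zero g ⟨mobius h ω.1, mobius_notMem h ω⟩
    simp only [mobius] at h3 ⊢
    rw [div_eq_div_iff h1 h3]
    simp only [Units.val_mul, Matrix.mul_apply, Fin.sum_univ_two, map_add, map_mul]
    field_simp
    ring

/-- The norm `(u, v) ↦ |u ω + v|` on `k ⊕ k`. -/
def HalfPlane.toNorm (ω : HalfPlane k) : PlaneNorm k where
  toFun x := ‖algebraMap k (CompletedClosure k) (x 0) * ω.1 + algebraMap k _ (x 1)‖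
  nonneg x := norm_nonneg _
  eq_zero_iff x := by
    rw [norm_eq_zero]
    constructor
    · intro h
      obtain ⟨h0, h1⟩ := ω.eq_zero h
      ext i
      fin_cases i
      · exact h0
      · exact h1
    · rintro rfl
      simp
  smul a x := by
    rw [← norm_algebraMap' (CompletedClosure k) a, ← norm_mul]
    simp only [Pi.smul_apply, smul_eq_mul, map_mul]
    congr 1
    ring
  add_le_max x y := by
    refine le_trans (le_of_eq ?_) (IsUltrametricDist.norm_add_le_max _ _)
    simp only [Pi.add_apply, map_add]
    congr 1
    ring

/-- The building map from the half-plane to the tree. -/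
def buildingMap (ω : HalfPlane k) : TreePoint k := Quotient.mk _ ω.toNorm

end HalfPlane

end LocalField

/-! ### Part 2. Function fields, places, and the Drinfeld modular group -/

section FunctionField

variable (F K : Type*) [Field F] [Field K] [Algebra F K]

/-- `K` is an algebraic function field of one variable with (exact) constant field `F`. -/
structure IsFunctionField : Prop where
  /-- `K` is a finite extension of a rational function field `F(t)`. -/
  exists_finite : ∃ t : K, Transcendental F t ∧ FiniteDimensional F⟮t⟯ K
  /-- Every element of `K` that is algebraic over `F` lies in `F`. -/
  constants : ∀ x : K, IsAlgebraic F x → x ∈ Set.range (algebraMap F K)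

/-- A place of `K` over `F`, given by its normalized discrete valuation, in multiplicative
notation. -/
@[ext] structure Place where
  val : Valuation K ℤᵐ⁰
  surjective : Function.Surjective val
  trivial_on_constants : ∀ a : F, a ≠ 0 → val (algebraMap F K a) = 1

namespace Place

variable {F K} (P : Place F K)

/-- The valuation ring of a place in `K`. -/
def ring : ValuationSubring K := P.val.valuationSubring

theorem algebraMap_mem (a : F) : algebraMap F K a ∈ P.ring := by
  rw [ring, Valuation.mem_valuationSubring_iff]
  rcases eq_or_ne a 0 with rfl | ha
  · simp
  · exact (P.trivial_on_constants a ha).le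

instance : Algebra F P.ring :=
  ((algebraMap F K).codRestrict P.ring P.algebraMap_mem).toAlgebra

/-- The degree of a place: the degree of its residue field over the constant field. -/
def degree : ℕ := Module.finrank F (IsLocalRing.ResidueField P.ring)

/-- The ring of all elements of `K` that are integral outside the place `P`. -/
def integralOutside : Subring K where
  carrier := {x | ∀ Q : Place F K, Q ≠ P → Q.val x ≤ 1}
  mul_mem' {x y} hx hy Q hQ := by
    rw [map_mul]
    exact mul_le_one' (hx Q hQ) (hy Q hQ)
  one_mem' Q _ := by rw [map_one]
  add_mem' {x y} hx hy Q hQ := (Q.val.map_add x y).trans (max_le (hx Q hQ) (hy Q hQ))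
  zero_mem' Q _ := by rw [map_zero]; exact zero_le_one
  neg_mem' {x} hx Q hQ := by
    rw [Valuation.map_neg]
    exact hx Q hQ

variable [Finite F]

theorem one_lt_card : 1 < (Nat.card F : ℝ≥0) := by
  exact_mod_cast Finite.one_lt_card

/-- The absolute value `|x| = q ^ (-ν(x))` of a place, where `q` is the order of `F` and `ν` is the
normalized additive valuation. -/
def absValue : AbsoluteValue K ℝ where
  toFun x := WithZeroMulInt.toNNReal (one_lt_card (F := F)).ne_zero (P.val x)
  map_mul' x y := by simp
  nonneg' x := NNReal.coe_nonneg _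
  eq_zero' x := by simp
  add_le' x y := by
    have hm := (WithZeroMulInt.toNNReal_strictMono (one_lt_card (F := F))).monotone
    have h := hm (P.val.map_add x y)
    rw [hm.map_max] at h
    exact_mod_cast h.trans (max_le_add_of_nonneg zero_le zero_le)

theorem absValue_add_le_max (x y : K) :
    P.absValue (x + y) ≤ max (P.absValue x) (P.absValue y) := by
  have hm := (WithZeroMulInt.toNNReal_strictMono (one_lt_card (F := F))).monotone
  have h := hm (P.val.map_add x y)
  rw [hm.map_max] at h
  exact_mod_cast h

theorem exists_one_lt_absValue : ∃ x : K, 1 < P.absValue x := by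
  obtain ⟨x, hx⟩ := P.surjective (WithZero.exp 1)
  refine ⟨x, ?_⟩
  have hm := WithZeroMulInt.toNNReal_strictMono (one_lt_card (F := F))
  have h : (1 : ℤᵐ⁰) < P.val x := by
    rw [hx, ← WithZero.exp_zero, WithZero.exp_lt_exp]
    exact one_pos
  have := hm h
  rw [map_one] at this
  exact_mod_cast this

/-- The completion of `K` at a place. -/
abbrev Completion : Type _ := P.absValue.Completion

/-- The embedding of `K` into its completion. -/
def toCompletion : K →+* P.Completion :=
  (UniformSpace.Completion.coeRingHom (α := WithAbs P.absValue)).comp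
    (WithAbs.equiv P.absValue).symm.toRingHom

theorem norm_toCompletion (x : K) : ‖P.toCompletion x‖ = P.absValue x := by
  show ‖((WithAbs.toAbs P.absValue x : WithAbs P.absValue) : P.Completion)‖ = _
  rw [UniformSpace.Completion.norm_coe]
  rfl

instance : NontriviallyNormedField P.Completion where
  non_trivial := by
    obtain ⟨x, hx⟩ := P.exists_one_lt_absValue
    exact ⟨P.toCompletion x, by rwa [norm_toCompletion]⟩

instance : IsUltrametricDist P.Completion := by
  refine IsUltrametricDist.isUltrametricDist_of_forall_norm_add_le_max_norm fun x y => ?_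
  induction x, y using UniformSpace.Completion.induction_on₂ with
  | hp => exact isClosed_le (by fun_prop) (by fun_prop)
  | ih x y =>
    rw [← UniformSpace.Completion.coe_add]
    simp only [UniformSpace.Completion.norm_coe]
    exact P.absValue_add_le_max x.ofAbs y.ofAbs

/-- The Drinfeld modular group `GL₂(A)`, where `A` is the ring of all elements of `K` that are
integral outside `P`. -/
abbrev ModularGroup : Type _ := GL (Fin 2) P.integralOutside

/-- The embedding of the modular group into `GL₂` of the completion of `K`. -/
def modularEmbedding : P.ModularGroup →* GL (Fin 2) P.Completion :=
  Matrix.GeneralLinearGroup.map (P.toCompletion.comp P.integralOutside.subtype)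

/-- The stabilizer in the modular group of a vertex of the tree. -/
def vertexStabilizer (v : Vertex P.Completion) : Subgroup P.ModularGroup :=
  (MulAction.stabilizer (GL (Fin 2) P.Completion) v).comap P.modularEmbedding

/-- The stabilizer in the modular group of a point of the half-plane. -/
def pointStabilizer (ω : HalfPlane P.Completion) : Subgroup P.ModularGroup :=
  (MulAction.stabilizer (GL (Fin 2) P.Completion) ω).comap P.modularEmbedding

/-- A point of the half-plane is elliptic if its stabilizer in the modular group does not consist
entirely of scalar matrices. -/
def IsElliptic (ω : HalfPlane P.Completion) : Prop :=
  ∃ g ∈ P.pointStabilizer ω, ¬ ∃ a, g.val = Matrix.scalar (Fin 2) a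

end Place

end FunctionField

end DrinfeldModular

end

/-!
A point of the half-plane and a vertex of the tree are compared through norms on the plane: the
stabilizer of `[L]` in `GL₂(A)` consists of the matrices preserving the norm of `L`
(`mem_vertexStabilizer_iff`), because determinants in `Aˣ` have absolute value one. The entries of
such matrices are functions with bounded poles at `∞` only, so the stabilizer is finite; trace and
determinant are integral everywhere, hence constant (`exists_trace_eq`). This rests on the fact that
a nonconstant function of `K` has a pole at some place (`IsFunctionField.exists_pole`): a valuation
ring not containing the function exists by Zorn's lemma, and it is discrete because `K` is finite
over some `F(t)`; separability is not needed.

If `ω` is elliptic with `λ(ω) = [L]`, a nonscalar matrix `g` fixing `ω` also fixes `[L]`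
(`smul_mk_eq_of_buildingMap_eq`). Its characteristic polynomial has coefficients in `F`, and no roots
there since `ω` does not lie in the completion. So `F[g]` is a field with `q ^ 2` elements, all its
units fix `ω` and hence `[L]`, and Lagrange's theorem gives the divisibility.

Conversely, divisibility of the order by `q ^ 2 - 1` forces the stabilizer to contain a matrix `g`
without eigenvalues in `F` (`exists_no_root_of_dvd_card`). As the degree of `∞` is odd, its
characteristic polynomial stays irreducible over the residue field (`one_le_norm_quadratic`). Then
`g` has a fixed point `ω` in the half-plane, and all `g`-invariant norms are similar
(`PlaneNorm.similarity_of_invariant`): for each of them `y` and `y g` are orthogonal vectors of equal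
length. Both the norm of `ω` and the norm of `L` are invariant, so that `λ(ω) = [L]`.
-/

noncomputable section

/-! ### Existence of places and the field of constants -/

namespace Valuation

variable {L Γ : Type*} [Field L] [LinearOrderedCommGroupWithZero Γ] (v : Valuation L Γ)

theorem exists_eq_of_sum_eq_zero {ι : Type*} {s : Finset ι} {f : ι → L} (hs : s.Nonempty)
    (hf : ∀ i ∈ s, f i ≠ 0) (h : ∑ i ∈ s, f i = 0) :
    ∃ i ∈ s, ∃ j ∈ s, i ≠ j ∧ v (f i) = v (f j) := by
  classical
  obtain ⟨i, hi, hmax⟩ := s.exists_max_image (fun i => v (f i)) hs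
  by_contra! hne
  have hlt : v (∑ j ∈ s.erase i, f j) < v (f i) := by
    refine v.map_sum_lt ((v.ne_zero_iff).2 (hf i hi)) fun j hj => ?_
    have hj' := Finset.mem_erase.1 hj
    exact lt_of_le_of_ne (hmax j hj'.2) (hne j hj'.2 i hi hj'.1)
  have := v.map_add_eq_of_lt_left hlt
  rw [Finset.add_sum_erase s f hi, h, map_zero] at this
  exact (v.ne_zero_iff).2 (hf i hi) this.symm

/-- In a finite extension of `E`, the value of an element has a power of bounded exponent among the
values of `E`: two terms of an algebraic equation over `E` must have the same value. -/
theorem exists_pow_eq_of_finite {E : Type*} [Field E] [Algebra E L] [FiniteDimensional E L]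
    {z : L} (hz : z ≠ 0) :
    ∃ i : ℕ, 0 < i ∧ i ≤ Module.finrank E L ∧
      ∃ a : E, a ≠ 0 ∧ v z ^ i = v (algebraMap E L a) := by
  have hint : IsIntegral E z := Algebra.IsIntegral.isIntegral z
  set p := minpoly E z with hp
  have hp0 : p ≠ 0 := minpoly.ne_zero hint
  have hsum : ∑ i ∈ p.support, algebraMap E L (p.coeff i) * z ^ i = 0 := by
    have := minpoly.aeval E z
    rwa [Polynomial.aeval_eq_sum_range, ← hp, Finset.sum_congr rfl
      (fun i _ => Algebra.smul_def _ _),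
      ← Finset.sum_subset Polynomial.supp_subset_range_natDegree_succ] at this
    intro i _ hi
    rw [Polynomial.notMem_support_iff.1 hi, map_zero, zero_mul]
  have hne : ∀ i ∈ p.support, algebraMap E L (p.coeff i) * z ^ i ≠ 0 := fun i hi =>
    mul_ne_zero (by simpa using Polynomial.mem_support_iff.1 hi) (pow_ne_zero _ hz)
  obtain ⟨i, hi, j, hj, hij, h⟩ :=
    v.exists_eq_of_sum_eq_zero (Polynomial.support_nonempty.2 hp0) hne hsum
  wlog hlt : i < j generalizing i j
  · exact this j hj i hi hij.symm h.symm (by omega)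
  refine ⟨j - i, by omega, ?_, p.coeff i / p.coeff j,
    div_ne_zero (Polynomial.mem_support_iff.1 hi) (Polynomial.mem_support_iff.1 hj), ?_⟩
  · have h1 := Polynomial.le_natDegree_of_mem_supp _ hj
    have h2 := minpoly.natDegree_le (A := E) z
    rw [← hp] at h2
    omega
  · have hvz : v z ^ i ≠ 0 := pow_ne_zero _ ((v.ne_zero_iff).2 hz)
    have hvj : v (algebraMap E L (p.coeff j)) ≠ 0 := (v.ne_zero_iff).2
      (by simpa using Polynomial.mem_support_iff.1 hj)
    rw [map_mul, map_mul, map_pow, map_pow] at h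
    rw [map_div₀, map_div₀, eq_div_iff hvj]
    refine mul_right_cancel₀ hvz ?_
    rw [h, mul_right_comm, ← pow_add, Nat.sub_add_cancel hlt.le, mul_comm]

end Valuation

namespace DrinfeldModular

section Places

variable {F K : Type*} [Field F] [Field K] [Algebra F K]

open Polynomial in
/-- A valuation of `F(s)` that is nontrivial, trivial on `F` and nonnegative at `s` is discrete: its
center on `F[s]` is a principal ideal, whose generator serves as uniformizer. -/
theorem exists_uniformizer_adjoin {Γ : Type*} [LinearOrderedCommGroupWithZero Γ]
    (v : Valuation K Γ) (hF : ∀ a : F, v (algebraMap F K a) ≤ 1) {s : K} (hs : v s ≤ 1)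
    (hnt : ∃ a ∈ F⟮s⟯, a ≠ 0 ∧ v a ≠ 1) :
    ∃ π : K, π ≠ 0 ∧ v π < 1 ∧ ∀ a ∈ F⟮s⟯, a ≠ 0 → ∃ m : ℤ, v a = v π ^ m := by
  have hpoly : ∀ p : F[X], v (aeval s p) ≤ 1 := fun p => by
    rw [aeval_eq_sum_range]
    refine v.map_sum_le fun i _ => ?_
    rw [Algebra.smul_def, map_mul, map_pow]
    exact mul_le_one' (hF _) (pow_le_one' hs i)
  let I : Ideal F[X] :=
    { carrier := {p | v (aeval s p) < 1}
      add_mem' := fun {p q} hp hq => by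
        show v (aeval s (p + q)) < 1
        rw [map_add]
        exact v.map_add_lt hp hq
      zero_mem' := by
        show v (aeval s (0 : F[X])) < 1
        simp
      smul_mem' := fun c p hp => by
        show v (aeval s (c * p)) < 1
        rw [map_mul, map_mul]
        exact (mul_le_of_le_one_left' (hpoly c)).trans_lt hp }
  obtain ⟨π, hπ⟩ := (IsPrincipalIdealRing.principal I).principal
  have hmem : ∀ p, v (aeval s p) < 1 ↔ π ∣ p := fun p => by
    rw [← Ideal.mem_span_singleton]
    change p ∈ I ↔ _
    rw [hπ]
  have hπ1 : v (aeval s π) < 1 := (hmem π).2 dvd_rfl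
  have hπu : ¬ IsUnit π := fun h => by
    have := (hmem 1).2 (isUnit_iff_dvd_one.1 h)
    simp at this
  have hfac : π ≠ 0 → ∀ p : F[X], p ≠ 0 → ∃ m : ℕ, v (aeval s p) = v (aeval s π) ^ m := by
    intro hπ0 p hp
    obtain ⟨c, hc, hdvd⟩ :=
      (FiniteMultiplicity.of_not_isUnit hπu hp).exists_eq_pow_mul_and_not_dvd
    refine ⟨multiplicity π p, ?_⟩
    have hc1 : v (aeval s c) = 1 :=
      le_antisymm (hpoly c) (not_lt.1 fun h => hdvd ((hmem c).1 h))
    conv_lhs => rw [hc]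
    rw [map_mul, map_mul, map_pow, map_pow, hc1, mul_one]
  have hne : aeval s π ≠ 0 := by
    obtain ⟨a, ha, ha0, ha1⟩ := hnt
    obtain ⟨p, q, rfl⟩ := (IntermediateField.mem_adjoin_simple_iff F a).1 ha
    intro h0
    have key : ∀ p : F[X], aeval s p ≠ 0 → v (aeval s p) = 1 := fun p hp =>
      le_antisymm (hpoly p) (not_lt.1 fun h => hp (by
        obtain ⟨c, rfl⟩ := (hmem p).1 h
        rw [map_mul, h0, zero_mul]))
    rw [div_ne_zero_iff] at ha0
    rw [map_div₀, key p ha0.1, key q ha0.2, div_one] at ha1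
    exact ha1 rfl
  refine ⟨aeval s π, hne, hπ1, fun a ha ha0 => ?_⟩
  have hπ0 : π ≠ 0 := fun h => hne (by rw [h, map_zero])
  obtain ⟨p, q, rfl⟩ := (IntermediateField.mem_adjoin_simple_iff F a).1 ha
  rw [div_ne_zero_iff] at ha0
  obtain ⟨m, hm⟩ := hfac hπ0 p (fun h => ha0.1 (by rw [h, map_zero]))
  obtain ⟨n, hn⟩ := hfac hπ0 q (fun h => ha0.2 (by rw [h, map_zero]))
  refine ⟨m - n, ?_⟩
  rw [map_div₀, hm, hn, zpow_sub₀ ((v.ne_zero_iff).2 hne), zpow_natCast, zpow_natCast]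

/-- The values of a nontrivial valuation of a function field, raised to a suitable power, are powers
of a single value. -/
theorem IsFunctionField.exists_pow_eq_zpow (hK : IsFunctionField F K)
    {Γ : Type*} [LinearOrderedCommGroupWithZero Γ] (v : Valuation K Γ)
    (hF : ∀ a : F, v (algebraMap F K a) ≤ 1) (hnt : ∃ x : K, x ≠ 0 ∧ v x ≠ 1) :
    ∃ π : K, π ≠ 0 ∧ v π < 1 ∧ ∃ N : ℕ, N ≠ 0 ∧ ∀ z : K, z ≠ 0 → ∃ m : ℤ, v z ^ N = v π ^ m := by
  obtain ⟨t, -, hfin⟩ := hK.exists_finite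
  have key : ∀ s : K, FiniteDimensional F⟮s⟯ K → v s ≤ 1 →
      ∃ π : K, π ≠ 0 ∧ v π < 1 ∧
        ∃ N : ℕ, N ≠ 0 ∧ ∀ z : K, z ≠ 0 → ∃ m : ℤ, v z ^ N = v π ^ m := by
    intro s hfin hs
    obtain ⟨x, hx0, hx1⟩ := hnt
    obtain ⟨i, hi, -, a, ha0, ha⟩ := v.exists_pow_eq_of_finite (E := F⟮s⟯) hx0
    have hnt' : ∃ a ∈ F⟮s⟯, a ≠ 0 ∧ v a ≠ 1 := by
      refine ⟨a, a.2, by simpa using ha0, fun h => hx1 ?_⟩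
      have h1 : v x ^ i = 1 := ha.trans h
      exact (pow_eq_one_iff_left hi.ne').1 h1
    obtain ⟨π, hπ0, hπ1, hπ⟩ := exists_uniformizer_adjoin v hF hs hnt'
    refine ⟨π, hπ0, hπ1, (Module.finrank F⟮s⟯ K).factorial, Nat.factorial_ne_zero _, ?_⟩
    intro z hz
    obtain ⟨i, hi, hin, a, ha0, ha⟩ := v.exists_pow_eq_of_finite (E := F⟮s⟯) hz
    obtain ⟨m, hm⟩ := hπ a a.2 (by simpa using ha0)
    obtain ⟨c, hc⟩ := Nat.dvd_factorial hi hin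
    refine ⟨m * c, ?_⟩
    rw [hc, pow_mul, ha, zpow_mul, zpow_natCast]
    exact congrArg (· ^ c) hm
  rcases le_total (v t) 1 with ht | ht
  · exact key t hfin ht
  · refine key t⁻¹ ?_ (by rw [map_inv₀]; exact inv_le_one_of_one_le₀ ht)
    have : F⟮t⁻¹⟯ = F⟮t⟯ := by
      refine le_antisymm ?_ ?_
      · rw [IntermediateField.adjoin_simple_le_iff]
        exact inv_mem (IntermediateField.mem_adjoin_simple_self F t)
      · rw [IntermediateField.adjoin_simple_le_iff]
        simpa using inv_mem (IntermediateField.mem_adjoin_simple_self F t⁻¹)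
    rwa [this]

/-- A nontrivial valuation of a function field is equivalent to a normalized discrete one. -/
theorem IsFunctionField.exists_place_of_valuation (hK : IsFunctionField F K)
    {Γ : Type*} [LinearOrderedCommGroupWithZero Γ] (v : Valuation K Γ)
    (hF : ∀ a : F, v (algebraMap F K a) ≤ 1) (hnt : ∃ x : K, x ≠ 0 ∧ v x ≠ 1) :
    ∃ Q : Place F K, ∀ x, Q.val x ≤ 1 ↔ v x ≤ 1 := by
  classical
  obtain ⟨π, hπ0, hπ1, N, hN, hpow⟩ := hK.exists_pow_eq_zpow v hF hnt
  choose! e he using hpow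
  have hvπ : 0 < v π := zero_lt_iff.2 ((v.ne_zero_iff).2 hπ0)
  have hle : ∀ x y : K, x ≠ 0 → y ≠ 0 → (v x ≤ v y ↔ e y ≤ e x) := fun x y hx hy => by
    rw [← pow_le_pow_iff_left₀ zero_le zero_le hN, he x hx, he y hy,
      zpow_le_zpow_iff_right_of_lt_one₀ hvπ hπ1]
  have hmul : ∀ x y : K, x ≠ 0 → y ≠ 0 → e (x * y) = e x + e y := fun x y hx hy => by
    refine (zpow_right_strictAnti₀ hvπ hπ1).injective ?_
    show v π ^ _ = v π ^ _
    rw [← he _ (mul_ne_zero hx hy), map_mul, mul_pow, he x hx, he y hy, zpow_add₀ hvπ.ne']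
  have hone : e 1 = 0 := by
    have := hmul 1 1 one_ne_zero one_ne_zero
    rw [mul_one] at this
    omega
  let f : Additive Kˣ →+ ℤ :=
    { toFun := fun u => e (u.toMul : Kˣ)
      map_zero' := hone
      map_add' := fun u w => hmul _ _ (Units.ne_zero _) (Units.ne_zero _) }
  obtain ⟨d, hd⟩ := Int.subgroup_cyclic f.range
  have hdvd : ∀ x : K, x ≠ 0 → d ∣ e x := fun x hx => by
    have : e x ∈ f.range := ⟨Additive.ofMul (Units.mk0 x hx), rfl⟩
    rw [hd, AddSubgroup.mem_closure_singleton] at this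
    obtain ⟨m, hm⟩ := this
    exact ⟨m, by rw [← hm, smul_eq_mul, mul_comm]⟩
  have hd0 : d ≠ 0 := by
    rintro rfl
    obtain ⟨x, hx0, hx1⟩ := hnt
    have h0 : e x = 0 := zero_dvd_iff.1 (hdvd x hx0)
    have := he x hx0
    rw [h0, zpow_zero] at this
    exact hx1 ((pow_eq_one_iff_left hN).1 this)
  wlog hdpos : 0 < d generalizing d
  · exact this (-d) (by rw [hd, AddSubgroup.closure_singleton_neg])
      (fun x hx => (neg_dvd).2 (hdvd x hx)) (neg_ne_zero.2 hd0) (by omega)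
  have hsurj : ∃ x : K, x ≠ 0 ∧ e x = d := by
    have : d ∈ f.range := by rw [hd]; exact AddSubgroup.subset_closure rfl
    obtain ⟨u, hu⟩ := this
    exact ⟨(u.toMul : Kˣ), Units.ne_zero _, hu⟩
  let w : K → ℤᵐ⁰ := fun x => if x = 0 then 0 else WithZero.exp (-(e x / d))
  have hw : ∀ x, x ≠ 0 → w x = WithZero.exp (-(e x / d)) := fun x hx => if_neg hx
  have hwle : ∀ x y, w x ≤ w y ↔ v x ≤ v y := by
    intro x y
    rcases eq_or_ne x 0 with rfl | hx
    · simp [w]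
    rcases eq_or_ne y 0 with rfl | hy
    · simp [w, hx]
    rw [hw x hx, hw y hy, WithZero.exp_le_exp, hle x y hx hy, neg_le_neg_iff]
    obtain ⟨a, ha⟩ := hdvd x hx
    obtain ⟨b, hb⟩ := hdvd y hy
    rw [ha, hb, Int.mul_ediv_cancel_left _ hd0, Int.mul_ediv_cancel_left _ hd0,
      mul_le_mul_iff_right₀ hdpos]
  have hw1 : w 1 = 1 := by
    rw [hw 1 one_ne_zero, hone, Int.zero_ediv, neg_zero, WithZero.exp_zero]
  have hwmul : ∀ x y, w (x * y) = w x * w y := by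
    intro x y
    rcases eq_or_ne x 0 with rfl | hx
    · simp [w]
    rcases eq_or_ne y 0 with rfl | hy
    · simp [w]
    rw [hw x hx, hw y hy, hw _ (mul_ne_zero hx hy), hmul x y hx hy,
      Int.add_ediv_of_dvd_left (hdvd x hx), neg_add, WithZero.exp_add]
  let W : Valuation K ℤᵐ⁰ :=
    { toFun := w
      map_zero' := if_pos rfl
      map_one' := hw1
      map_mul' := hwmul
      map_add_le_max' := fun x y => by
        rw [le_max_iff, hwle, hwle, ← le_max_iff]
        exact v.map_add x y }
  have hW : ∀ x, W x = w x := fun _ => rfl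
  have hle1 : ∀ x, W x ≤ 1 ↔ v x ≤ 1 := fun x => by rw [hW, ← hw1, hwle, map_one]
  refine ⟨⟨W, ?_, ?_⟩, hle1⟩
  · intro γ
    obtain ⟨x, hx0, hx⟩ := hsurj
    rcases eq_or_ne γ 0 with rfl | hγ
    · exact ⟨0, map_zero _⟩
    · refine ⟨x ^ (-(WithZero.log γ)), ?_⟩
      rw [map_zpow₀, hW, hw x hx0, hx, Int.ediv_self hd0, ← WithZero.exp_zsmul, smul_eq_mul,
        neg_mul_neg, mul_one, WithZero.exp_log hγ]
  · intro a ha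
    refine le_antisymm ((hle1 _).2 (hF a)) ?_
    have h1 : W (algebraMap F K a⁻¹) ≤ 1 := (hle1 _).2 (hF a⁻¹)
    rw [map_inv₀, map_inv₀] at h1
    have h0 : W (algebraMap F K a) ≠ 0 := (W.ne_zero_iff).2 (by simpa using ha)
    exact (inv_le_one₀ (zero_lt_iff.2 h0)).1 h1

/-- A nonconstant function has a pole. -/
theorem IsFunctionField.exists_pole (hK : IsFunctionField F K) {x : K}
    (hx : x ∉ Set.range (algebraMap F K)) : ∃ Q : Place F K, 1 < Q.val x := by
  have hint : x ∉ (integralClosure (Subring.closure (Set.range (algebraMap F K))) K).toSubring := by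
    intro h
    refine hx (hK.constants x ?_)
    have h' : IsIntegral (Subring.closure (Set.range (algebraMap F K))) x := h
    have hcl : Subring.closure (Set.range (algebraMap F K)) = (algebraMap F K).range := by
      rw [← RingHom.coe_range, Subring.closure_eq]
    rw [hcl] at h'
    have h2 : (algebraMap F K).IsIntegralElem x := by
      obtain ⟨p, hp, hpx⟩ := h'
      have hs : Function.Surjective (algebraMap F K).rangeRestrict :=
        (algebraMap F K).rangeRestrict_surjective
      have hlift : p ∈ Polynomial.lifts (algebraMap F K).rangeRestrict := by
        rw [Polynomial.mem_lifts]
        exact Polynomial.map_surjective _ hs p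
      obtain ⟨r, hr, -, hrm⟩ := Polynomial.lifts_and_natDegree_eq_and_monic hlift hp
      refine ⟨r, hrm, ?_⟩
      rw [← hr, Polynomial.eval₂_map] at hpx
      exact hpx
    exact IsIntegral.isAlgebraic h2
  rw [← iInf_valuationSubring_superset, Subring.mem_iInf] at hint
  push Not at hint
  obtain ⟨⟨V, hV⟩, hxV⟩ := hint
  have hxv : ¬ V.valuation x ≤ 1 := fun h => hxV ((V.valuation_le_one_iff x).1 h)
  obtain ⟨Q, hQ⟩ := hK.exists_place_of_valuation V.valuation
    (fun a => (V.valuation_le_one_iff _).2 (hV ⟨a, rfl⟩))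
    ⟨x, by rintro rfl; simp at hxv, fun h => hxv h.le⟩
  exact ⟨Q, not_le.1 fun h => hxv ((hQ x).1 h)⟩

/-- The only functions without poles are the constants. -/
theorem IsFunctionField.mem_range_of_val_le_one (hK : IsFunctionField F K) (P : Place F K) {x : K}
    (hx : x ∈ P.integralOutside) (hxP : P.val x ≤ 1) : x ∈ Set.range (algebraMap F K) := by
  by_contra h
  obtain ⟨Q, hQ⟩ := hK.exists_pole h
  rcases eq_or_ne Q P with rfl | hne
  · exact absurd hxP (not_le.2 hQ)
  · exact absurd (hx Q hne) (not_le.2 hQ)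

end Places

end DrinfeldModular

namespace DrinfeldModular

/-! ### Stabilizers of vertices in terms of lattice norms -/

section LocalField

set_option linter.unusedSectionVars false

variable {k : Type*} [NontriviallyNormedField k] [IsUltrametricDist k]

open Matrix

namespace PlaneLattice

/-- The vertex of the tree given by a lattice. -/
def toVertex (L : PlaneLattice k) : Vertex k := Quotient.mk (homothety k) L

theorem exists_toNorm_eq (L : PlaneLattice k) :
    ∃ b : Module.Basis (Fin 2) k (Fin 2 → k),
      ∀ x, L.toNorm.toFun x = max ‖b.repr x 0‖ ‖b.repr x 1‖ := by
  obtain ⟨b, hb⟩ := L.2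
  refine ⟨b, fun x => ?_⟩
  show latticeGauge L.1 x = _
  rw [hb, latticeGauge_eq]

theorem mem_iff_toNorm_le_one (L : PlaneLattice k) (x : Fin 2 → k) :
    x ∈ L.1 ↔ L.toNorm.toFun x ≤ 1 := by
  obtain ⟨b, hb⟩ := L.2
  show _ ↔ latticeGauge L.1 x ≤ 1
  rw [hb, latticeGauge_eq, mem_span_basis_iff, max_le_iff, Fin.forall_fin_two]

theorem exists_toNorm_eq_norm (L : PlaneLattice k) (x : Fin 2 → k) :
    ∃ a : k, L.toNorm.toFun x = ‖a‖ := by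
  obtain ⟨b, hb⟩ := L.exists_toNorm_eq
  rw [hb]
  rcases max_choice ‖b.repr x 0‖ ‖b.repr x 1‖ with h | h
  · exact ⟨_, h⟩
  · exact ⟨_, h⟩

theorem toNorm_le_norm_iff (L : PlaneLattice k) (x : Fin 2 → k) {a : k} (ha : a ≠ 0) :
    L.toNorm.toFun x ≤ ‖a‖ ↔ a⁻¹ • x ∈ L.1 := by
  rw [mem_iff_toNorm_le_one, L.toNorm.smul, norm_inv, inv_mul_le_one₀ (norm_pos_iff.2 ha)]

theorem mem_smul_iff_vecMul_mem (g : GL (Fin 2) k) (L : PlaneLattice k) (x : Fin 2 → k) :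
    x ∈ (g • L).1 ↔ x ᵥ* g.val ∈ L.1 := by
  rw [mem_smul]
  constructor
  · rintro ⟨y, hy, rfl⟩
    have : rowAct g y ᵥ* g.val = y := (rowAct g).symm_apply_apply y
    rwa [this]
  · intro h
    exact ⟨_, h, (rowAct g).apply_symm_apply x⟩

end PlaneLattice

theorem vecMul_ne_zero (g : GL (Fin 2) k) {x : Fin 2 → k} (hx : x ≠ 0) : x ᵥ* g.val ≠ 0 :=
  fun h => hx ((rowAct g).symm.map_eq_zero_iff.1 h)

/-- A matrix fixes the class of a lattice iff it scales the norm of the lattice by a value of the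
field. -/
theorem smul_mk_eq_iff (g : GL (Fin 2) k) (L : PlaneLattice k) :
    g • L.toVertex = L.toVertex ↔
      ∃ c : k, c ≠ 0 ∧ ∀ x, L.toNorm.toFun (x ᵥ* g.val) = ‖c‖ * L.toNorm.toFun x := by
  have h0 : g • L.toVertex = L.toVertex ↔
      ∃ c : k, c ≠ 0 ∧ ∀ x, x ∈ (g • L).1 ↔ c • x ∈ L.1 :=
    Quotient.eq (r := homothety k) (x := g • L) (y := L)
  rw [h0]
  refine exists_congr fun c => and_congr_right fun hc => ?_
  simp only [PlaneLattice.mem_smul_iff_vecMul_mem]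
  constructor
  · intro h x
    rcases eq_or_ne x 0 with rfl | hx
    · rw [zero_vecMul, (L.toNorm.eq_zero_iff 0).2 rfl, mul_zero]
    rw [← L.toNorm.smul]
    have key : ∀ a : k, a ≠ 0 → (L.toNorm.toFun (x ᵥ* g.val) ≤ ‖a‖ ↔
        L.toNorm.toFun (c • x) ≤ ‖a‖) := fun a ha => by
      rw [L.toNorm_le_norm_iff _ ha, L.toNorm_le_norm_iff _ ha, ← smul_vecMul, h, smul_comm]
    obtain ⟨a, ha⟩ := L.exists_toNorm_eq_norm (x ᵥ* g.val)
    obtain ⟨d, hd⟩ := L.exists_toNorm_eq_norm (c • x)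
    have ha0 : a ≠ 0 := by
      rintro rfl
      rw [norm_zero, L.toNorm.eq_zero_iff] at ha
      exact vecMul_ne_zero g hx ha
    have hd0 : d ≠ 0 := by
      rintro rfl
      rw [norm_zero, L.toNorm.eq_zero_iff] at hd
      exact smul_ne_zero hc hx hd
    exact le_antisymm (hd ▸ (key d hd0).2 hd.le) (ha ▸ (key a ha0).1 ha.le)
  · intro h x
    rw [L.mem_iff_toNorm_le_one, L.mem_iff_toNorm_le_one, h, L.toNorm.smul]

theorem norm_toMatrix_le {L : PlaneLattice k} {b : Module.Basis (Fin 2) k (Fin 2 → k)}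
    (hb : ∀ x, L.toNorm.toFun x = max ‖b.repr x 0‖ ‖b.repr x 1‖) {r : ℝ}
    {f : (Fin 2 → k) →ₗ[k] (Fin 2 → k)} (hf : ∀ x, L.toNorm.toFun (f x) ≤ r * L.toNorm.toFun x)
    (i j : Fin 2) : ‖LinearMap.toMatrix b b f i j‖ ≤ r := by
  rw [LinearMap.toMatrix_apply]
  have h1 : ‖b.repr (f (b j)) i‖ ≤ L.toNorm.toFun (f (b j)) := by
    rw [hb]
    fin_cases i
    · exact le_max_left _ _
    · exact le_max_right _ _
  have h2 : L.toNorm.toFun (b j) = 1 := by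
    rw [hb, b.repr_self]
    fin_cases j <;> simp
  refine h1.trans ((hf _).trans ?_)
  rw [h2, mul_one]

theorem norm_det_le_of_toNorm_le (L : PlaneLattice k) (M : Matrix (Fin 2) (Fin 2) k) {r : ℝ}
    (hM : ∀ x, L.toNorm.toFun (x ᵥ* M) ≤ r * L.toNorm.toFun x) : ‖M.det‖ ≤ r * r := by
  obtain ⟨b, hb⟩ := L.exists_toNorm_eq
  have h := norm_toMatrix_le hb (f := Matrix.toLin' Mᵀ)
    (fun x => by rw [toLin'_apply, mulVec_transpose]; exact hM x)
  have hr : 0 ≤ r := (norm_nonneg _).trans (h 0 0)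
  rw [← det_transpose, ← LinearMap.det_toLin', ← LinearMap.det_toMatrix b, det_fin_two,
    sub_eq_add_neg]
  refine (IsUltrametricDist.norm_add_le_max _ _).trans (max_le ?_ ?_) <;>
    simp only [norm_neg, norm_mul] <;>
    exact mul_le_mul (h _ _) (h _ _) (norm_nonneg _) hr

theorem norm_trace_le_of_toNorm_le (L : PlaneLattice k) (M : Matrix (Fin 2) (Fin 2) k) {r : ℝ}
    (hM : ∀ x, L.toNorm.toFun (x ᵥ* M) ≤ r * L.toNorm.toFun x) : ‖M.trace‖ ≤ r := by
  obtain ⟨b, hb⟩ := L.exists_toNorm_eq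
  have h := norm_toMatrix_le hb (f := Matrix.toLin' Mᵀ)
    (fun x => by rw [toLin'_apply, mulVec_transpose]; exact hM x)
  rw [← trace_transpose, ← Matrix.trace_toLin'_eq, LinearMap.trace_eq_matrix_trace k b,
    trace_fin_two]
  exact (IsUltrametricDist.norm_add_le_max _ _).trans (max_le (h _ _) (h _ _))

/-- A matrix whose determinant is a unit fixes the class of a lattice iff it preserves the norm of
the lattice. -/
theorem smul_mk_eq_iff_of_norm_det {g : GL (Fin 2) k} (hg : ‖g.val.det‖ = 1) (L : PlaneLattice k) :
    g • L.toVertex = L.toVertex ↔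
      ∀ x, L.toNorm.toFun (x ᵥ* g.val) = L.toNorm.toFun x := by
  rw [smul_mk_eq_iff]
  constructor
  · rintro ⟨c, hc, h⟩ x
    have hc0 : 0 < ‖c‖ := norm_pos_iff.2 hc
    have h1 := norm_det_le_of_toNorm_le L g.val (fun x => (h x).le)
    have h2 := norm_det_le_of_toNorm_le L (g⁻¹).val (r := ‖c‖⁻¹) (fun x => by
      have := h (x ᵥ* (g⁻¹).val)
      rw [vecMul_vecMul, Units.inv_mul, vecMul_one] at this
      rw [this, inv_mul_cancel_left₀ hc0.ne'])
    have h3 : ‖(g⁻¹).val.det‖ = 1 := by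
      have h4 : g.val.det * (g⁻¹).val.det = 1 := by rw [← det_mul, Units.mul_inv, det_one]
      have h5 := congrArg norm h4
      rwa [norm_mul, hg, one_mul, norm_one] at h5
    rw [hg] at h1
    rw [h3, ← mul_inv] at h2
    have h6 : ‖c‖ * ‖c‖ ≤ 1 := by
      have := (one_le_inv₀ (by positivity)).1 h2
      exact this
    have h7 : ‖c‖ = 1 := by nlinarith
    rw [h, h7, one_mul]
  · intro h
    exact ⟨1, one_ne_zero, fun x => by rw [h, norm_one, one_mul]⟩

theorem exists_norm_entry_le (L : PlaneLattice k) :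
    ∃ C : ℝ, ∀ M : Matrix (Fin 2) (Fin 2) k,
      (∀ x, L.toNorm.toFun (x ᵥ* M) = L.toNorm.toFun x) → ∀ i j, ‖M i j‖ ≤ C := by
  obtain ⟨b, hb⟩ := L.exists_toNorm_eq
  have hB : ∀ x j, ‖x j‖ ≤ (∑ i, ∑ j, ‖b i j‖) * L.toNorm.toFun x := by
    intro x j
    have hle : ∀ i, ‖b i j‖ ≤ ∑ i, ∑ j, ‖b i j‖ := fun i =>
      (Finset.single_le_sum (f := fun j => ‖b i j‖) (fun _ _ => norm_nonneg _)
        (Finset.mem_univ j)).trans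
      (Finset.single_le_sum (f := fun i => ∑ j, ‖b i j‖)
        (fun _ _ => Finset.sum_nonneg fun _ _ => norm_nonneg _) (Finset.mem_univ i))
    have hS : 0 ≤ ∑ i, ∑ j, ‖b i j‖ := (norm_nonneg _).trans (hle 0)
    have hx : x j = b.repr x 0 * b 0 j + b.repr x 1 * b 1 j := by
      conv_lhs => rw [← b.sum_repr x]
      simp [Fin.sum_univ_two]
    rw [hx, hb, mul_comm (∑ i, ∑ j, ‖b i j‖)]
    refine (IsUltrametricDist.norm_add_le_max _ _).trans (max_le ?_ ?_) <;> rw [norm_mul]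
    · exact mul_le_mul (le_max_left _ _) (hle 0) (norm_nonneg _)
        (le_max_of_le_left (norm_nonneg _))
    · exact mul_le_mul (le_max_right _ _) (hle 1) (norm_nonneg _)
        (le_max_of_le_left (norm_nonneg _))
  refine ⟨(∑ i, ∑ j, ‖b i j‖) * ∑ i, L.toNorm.toFun (Pi.single i 1), fun M hM i j => ?_⟩
  have h1 := hB (Pi.single i 1 ᵥ* M) j
  rw [hM, single_one_vecMul] at h1
  refine h1.trans (mul_le_mul_of_nonneg_left ?_ ?_)
  · exact Finset.single_le_sum (f := fun i => L.toNorm.toFun (Pi.single i 1))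
      (fun _ _ => L.toNorm.nonneg _) (Finset.mem_univ i)
  · exact Finset.sum_nonneg fun _ _ => Finset.sum_nonneg fun _ _ => norm_nonneg _

/-! ### Norms invariant under an elliptic matrix -/

theorem vecMul_vecMul_self (M : Matrix (Fin 2) (Fin 2) k) (y : Fin 2 → k) :
    (y ᵥ* M) ᵥ* M = M.trace • (y ᵥ* M) - M.det • y := by
  ext j
  fin_cases j <;>
    simp [Matrix.vecMul, dotProduct, Fin.sum_univ_two, trace_fin_two, det_fin_two] <;> ring

namespace PlaneNorm

theorem neg (N : PlaneNorm k) (x : Fin 2 → k) : N.toFun (-x) = N.toFun x := by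
  rw [← neg_one_smul k x, N.smul, norm_neg, norm_one, one_mul]

theorem add_eq_of_lt (N : PlaneNorm k) {x y : Fin 2 → k} (h : N.toFun x < N.toFun y) :
    N.toFun (x + y) = N.toFun y := by
  refine le_antisymm ((N.add_le_max x y).trans (max_le h.le le_rfl)) ?_
  have h1 := N.add_le_max (x + y) (-x)
  rw [add_neg_cancel_comm, N.neg] at h1
  exact (le_max_iff.1 h1).resolve_right (not_le.2 h)

/-- If the characteristic polynomial of `M` has no root modulo the maximal ideal, then `y` and `y M`
form an orthogonal basis for every `M`-invariant norm. -/
theorem toFun_add_smul_vecMul (N : PlaneNorm k) {M : Matrix (Fin 2) (Fin 2) k}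
    (hN : ∀ x, N.toFun (x ᵥ* M) = N.toFun x) (ht : ‖M.trace‖ ≤ 1)
    (hM : ∀ u : k, ‖u‖ ≤ 1 → 1 ≤ ‖u ^ 2 - M.trace * u + M.det‖) (y : Fin 2 → k) (u w : k) :
    N.toFun (u • y + w • (y ᵥ* M)) = max ‖u‖ ‖w‖ * N.toFun y := by
  rcases eq_or_ne y 0 with rfl | hy
  · rw [zero_vecMul, smul_zero, smul_zero, add_zero, (N.eq_zero_iff 0).2 rfl, mul_zero]
  have hy0 : 0 < N.toFun y := lt_of_le_of_ne (N.nonneg y) fun h => hy ((N.eq_zero_iff y).1 h.symm)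
  rcases lt_trichotomy ‖u‖ ‖w‖ with h | h | h
  · rw [N.add_eq_of_lt, N.smul, hN, max_eq_right h.le]
    rw [N.smul, N.smul, hN]
    exact mul_lt_mul_of_pos_right h hy0
  · rcases eq_or_ne w 0 with rfl | hw
    · rw [norm_zero, norm_eq_zero] at h
      simp [h, (N.eq_zero_iff 0).2 rfl]
    have hw0 : 0 < ‖w‖ := norm_pos_iff.2 hw
    have hs : ‖u / w‖ ≤ 1 := by rw [norm_div, h, div_self hw0.ne']
    have hfac : u • y + w • (y ᵥ* M) = w • ((u / w) • y + y ᵥ* M) := by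
      rw [smul_add, smul_smul, mul_div_cancel₀ u hw]
    rw [hfac, N.smul, h, max_self]
    congr 1
    generalize u / w = s at hs
    refine le_antisymm ?_ (not_lt.1 fun hlt => ?_)
    · refine (N.add_le_max _ _).trans (max_le ?_ ?_)
      · rw [N.smul]
        exact mul_le_of_le_one_left (N.nonneg _) hs
      · rw [hN]
    -- `(M + s)(M - tr M - s) = -χ(-s)`, where `χ` is the characteristic polynomial of `M`
    · have hid : ((-s) ^ 2 - M.trace * (-s) + M.det) • y
          = -((s • y + y ᵥ* M) ᵥ* M + (-(M.trace + s)) • (s • y + y ᵥ* M)) := by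
        rw [add_vecMul, smul_vecMul, vecMul_vecMul_self]
        module
      have h1 := congrArg N.toFun hid
      rw [N.smul, N.neg] at h1
      have h2 : N.toFun ((s • y + y ᵥ* M) ᵥ* M + (-(M.trace + s)) • (s • y + y ᵥ* M))
          ≤ N.toFun (s • y + y ᵥ* M) := by
        refine (N.add_le_max _ _).trans (max_le (hN _).le ?_)
        rw [N.smul, norm_neg]
        exact mul_le_of_le_one_left (N.nonneg _)
          ((IsUltrametricDist.norm_add_le_max _ _).trans (max_le ht hs))
      have h3 := hM (-s) (by rwa [norm_neg])
      have h4 := mul_le_mul_of_nonneg_right h3 hy0.le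
      rw [one_mul] at h4
      linarith
  · rw [add_comm, N.add_eq_of_lt, N.smul, max_eq_left h.le]
    rw [N.smul, N.smul, hN]
    exact mul_lt_mul_of_pos_right h hy0

/-- If the characteristic polynomial of `M` has no root modulo the maximal ideal, then `M` fixes at
most one point of the tree. -/
theorem similarity_of_invariant {N N' : PlaneNorm k} {M : Matrix (Fin 2) (Fin 2) k}
    (hN : ∀ x, N.toFun (x ᵥ* M) = N.toFun x) (hN' : ∀ x, N'.toFun (x ᵥ* M) = N'.toFun x)
    (ht : ‖M.trace‖ ≤ 1) (hM : ∀ u : k, ‖u‖ ≤ 1 → 1 ≤ ‖u ^ 2 - M.trace * u + M.det‖) :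
    similarity k N N' := by
  set y : Fin 2 → k := Pi.single 0 1 with hy
  have hy0 : y ≠ 0 := by simp [hy]
  have hpos : ∀ N : PlaneNorm k, 0 < N.toFun y := fun N =>
    lt_of_le_of_ne (N.nonneg y) fun h => hy0 ((N.eq_zero_iff y).1 h.symm)
  have hli : LinearIndependent k ![y, y ᵥ* M] := by
    rw [LinearIndependent.pair_iff]
    intro u w h
    have h1 := N.toFun_add_smul_vecMul hN ht hM y u w
    rw [h, (N.eq_zero_iff 0).2 rfl, eq_comm, mul_eq_zero] at h1
    have h2 := h1.resolve_right (hpos N).ne'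
    exact ⟨norm_le_zero_iff.1 ((le_max_left _ _).trans h2.le),
      norm_le_zero_iff.1 ((le_max_right _ _).trans h2.le)⟩
  refine ⟨N'.toFun y / N.toFun y, div_pos (hpos N') (hpos N), fun x => ?_⟩
  have hx : x ∈ Submodule.span k (Set.range ![y, y ᵥ* M]) := by
    rw [hli.span_eq_top_of_card_eq_finrank (by simp)]
    trivial
  rw [Matrix.range_cons, Matrix.range_cons, Matrix.range_empty, Set.union_empty,
    Set.singleton_union, Submodule.mem_span_pair] at hx
  obtain ⟨u, w, rfl⟩ := hx
  rw [N.toFun_add_smul_vecMul hN ht hM, N'.toFun_add_smul_vecMul hN' ht hM]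
  field_simp [(hpos N).ne']

end PlaneNorm

/-! ### Fixed points in the half-plane -/

section HalfPlane

variable [CompleteSpace k]

theorem HalfPlane.smul_eq_iff (g : GL (Fin 2) k) (ω : HalfPlane k) :
    g • ω = ω ↔ algebraMap k (CompletedClosure k) (g 0 0) * ω.1 + algebraMap k _ (g 0 1)
      = (algebraMap k _ (g 1 0) * ω.1 + algebraMap k _ (g 1 1)) * ω.1 := by
  have h : g • ω = ω ↔ mobius g ω.1 = ω.1 := Subtype.ext_iff
  rw [h, mobius, div_eq_iff (denom_ne_zero g ω), mul_comm ω.1]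

theorem HalfPlane.toNorm_vecMul {g : GL (Fin 2) k} {ω : HalfPlane k} (h : g • ω = ω)
    (x : Fin 2 → k) : ω.toNorm.toFun (x ᵥ* g.val)
      = ‖algebraMap k (CompletedClosure k) (g 1 0) * ω.1 + algebraMap k _ (g 1 1)‖
        * ω.toNorm.toFun x := by
  rw [HalfPlane.smul_eq_iff] at h
  show ‖_‖ = _ * ‖_‖
  rw [← norm_mul]
  congr 1
  simp only [vecMul, dotProduct, Fin.sum_univ_two, map_add, map_mul]
  linear_combination algebraMap k (CompletedClosure k) (x 0) * h

/-- A matrix fixing a point of the half-plane whose image is a vertex fixes this vertex. -/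
theorem smul_mk_eq_of_buildingMap_eq {g : GL (Fin 2) k} {ω : HalfPlane k} (hg : g • ω = ω)
    {L : PlaneLattice k}
    (hL : buildingMap ω = L.toVertex.toPoint) :
    g • L.toVertex = L.toVertex := by
  obtain ⟨c, hc, h⟩ : similarity k ω.toNorm L.toNorm := Quotient.exact hL
  rw [smul_mk_eq_iff]
  have hx : (Pi.single 0 1 : Fin 2 → k) ≠ 0 := by simp
  obtain ⟨a, ha⟩ := L.exists_toNorm_eq_norm (Pi.single 0 1)
  obtain ⟨d, hd⟩ := L.exists_toNorm_eq_norm (Pi.single 0 1 ᵥ* g.val)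
  have ha0 : a ≠ 0 := by
    rintro rfl
    rw [norm_zero, L.toNorm.eq_zero_iff] at ha
    exact hx ha
  have hd0 : d ≠ 0 := by
    rintro rfl
    rw [norm_zero, L.toNorm.eq_zero_iff] at hd
    exact vecMul_ne_zero g hx hd
  have hscale : ∀ x, L.toNorm.toFun (x ᵥ* g.val)
      = ‖algebraMap k (CompletedClosure k) (g 1 0) * ω.1 + algebraMap k _ (g 1 1)‖
        * L.toNorm.toFun x := fun x => by
    rw [h, h, HalfPlane.toNorm_vecMul hg]
    ring
  refine ⟨d / a, div_ne_zero hd0 ha0, fun x => ?_⟩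
  have h1 := hscale (Pi.single 0 1)
  rw [hd, ha, ← div_eq_iff (norm_ne_zero_iff.2 ha0)] at h1
  rw [hscale, norm_div, h1]

/-- The automorphy factor `c ω + d` at a fixed point `ω` is an eigenvalue. -/
theorem HalfPlane.charpoly_denom {g : GL (Fin 2) k} {ω : HalfPlane k} (h : g • ω = ω) :
    (algebraMap k (CompletedClosure k) (g 1 0) * ω.1 + algebraMap k _ (g 1 1)) ^ 2
      - algebraMap k _ g.val.trace
        * (algebraMap k (CompletedClosure k) (g 1 0) * ω.1 + algebraMap k _ (g 1 1))
      + algebraMap k _ g.val.det = 0 := by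
  rw [HalfPlane.smul_eq_iff] at h
  rw [trace_fin_two, det_fin_two]
  simp only [map_add, map_mul, map_sub]
  linear_combination (-algebraMap k (CompletedClosure k) (g 1 0)) * h

/-- A matrix without eigenvalues in `k` has a fixed point in the half-plane. -/
theorem HalfPlane.exists_smul_eq (g : GL (Fin 2) k)
    (hg : ∀ u : k, u ^ 2 - g.val.trace * u + g.val.det ≠ 0) : ∃ ω : HalfPlane k, g • ω = ω := by
  have hc : g 1 0 ≠ 0 := fun hc => hg (g 1 1) (by
    rw [trace_fin_two, det_fin_two]
    linear_combination (-g 0 1) * hc)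
  obtain ⟨ε, hε⟩ : ∃ ε : CompletedClosure k,
      ε ^ 2 - algebraMap k _ g.val.trace * ε + algebraMap k _ g.val.det = 0 := by
    obtain ⟨ε, hε⟩ := IsAlgClosed.exists_aeval_eq_zero (AlgebraicClosure k) g.val.charpoly (by
      rw [charpoly_degree_eq_dim]; simp)
    refine ⟨(ε : UniformSpace.Completion (AlgebraicClosure k)), ?_⟩
    rw [charpoly_fin_two] at hε
    simp only [map_add, map_sub, map_mul, map_pow, Polynomial.aeval_X, Polynomial.aeval_C] at hε
    have := congrArg (UniformSpace.Completion.coeRingHom (α := AlgebraicClosure k)) hε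
    simp only [map_add, map_sub, map_mul, map_pow, map_zero] at this
    exact this
  have hc' : algebraMap k (CompletedClosure k) (g 1 0) ≠ 0 := by simpa using hc
  have hε' : ∀ u : k, algebraMap k (CompletedClosure k) u ≠ ε := by
    rintro u rfl
    refine hg u ((algebraMap k (CompletedClosure k)).injective ?_)
    simpa using hε
  have hω : algebraMap k (CompletedClosure k) (g 1 0)
      * ((ε - algebraMap k _ (g 1 1)) / algebraMap k _ (g 1 0)) + algebraMap k _ (g 1 1) = ε := by
    rw [mul_div_cancel₀ _ hc', sub_add_cancel]
  have hmem : (ε - algebraMap k _ (g 1 1)) / algebraMap k _ (g 1 0)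
      ∉ Set.range (algebraMap k (CompletedClosure k)) := by
    rintro ⟨u, hu⟩
    refine hε' (g 1 0 * u + g 1 1) ?_
    rw [map_add, map_mul, hu, hω]
  refine ⟨⟨_, hmem⟩, (HalfPlane.smul_eq_iff g ⟨_, hmem⟩).2 ?_⟩
  simp only [hω]
  field_simp
  rw [trace_fin_two, det_fin_two] at hε
  simp only [map_add, map_mul, map_sub] at hε
  linear_combination -hε

theorem norm_eq_one_of_quadratic {E : Type*} [NormedField E] [IsUltrametricDist E] {ε t n : E}
    (h : ε ^ 2 - t * ε + n = 0) (ht : ‖t‖ ≤ 1) (hn : ‖n‖ = 1) : ‖ε‖ = 1 := by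
  have h1 : ε * (t - ε) = n := by linear_combination -h
  have h2 : ‖ε‖ * ‖t - ε‖ = 1 := by rw [← norm_mul, h1, hn]
  have h3 : ‖t - ε‖ ≤ max ‖t‖ ‖ε‖ := by
    rw [sub_eq_add_neg, ← norm_neg ε]
    exact IsUltrametricDist.norm_add_le_max _ _
  have h0 := norm_nonneg ε
  have hle : ‖ε‖ ≤ 1 := by
    by_contra hlt
    push Not at hlt
    have h4 : ‖t - ε‖ = ‖ε‖ := by
      have hlt' : ‖t‖ < ‖-ε‖ := by rw [norm_neg]; linarith
      rw [sub_eq_add_neg, IsUltrametricDist.norm_add_eq_max_of_norm_ne_norm hlt'.ne,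
        max_eq_right hlt'.le, norm_neg]
    nlinarith
  refine le_antisymm hle ?_
  have h5 : ‖t - ε‖ ≤ 1 := h3.trans (max_le ht hle)
  nlinarith

end HalfPlane

end LocalField

end DrinfeldModular

/-! ### Finite groups of two-by-two matrices with split characteristic polynomials -/

namespace DrinfeldModular

section FiniteMatrixGroups

open Matrix Polynomial

variable {A : Type*} [CommRing A]

theorem mul_self_fin_two (M : Matrix (Fin 2) (Fin 2) A) :
    M * M = M.trace • M - M.det • (1 : Matrix (Fin 2) (Fin 2) A) := by
  ext i j
  fin_cases i <;> fin_cases j <;>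
    simp [Matrix.mul_apply, Fin.sum_univ_two, trace_fin_two, det_fin_two] <;> ring

theorem mul_add_mul_of_trace_eq_zero {M N : Matrix (Fin 2) (Fin 2) A} (hM : M.trace = 0)
    (hN : N.trace = 0) (hMN : (M * N).trace = 0) : M * N + N * M = 0 := by
  simp only [trace_fin_two, Matrix.mul_apply, Fin.sum_univ_two] at hM hN hMN
  ext i j
  fin_cases i <;> fin_cases j <;> simp [Matrix.mul_apply, Fin.sum_univ_two]
  · linear_combination hMN + M 0 0 * hN - hM * N 1 1
  · linear_combination M 0 1 * hN + N 0 1 * hM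
  · linear_combination M 1 0 * hN + N 1 0 * hM
  · linear_combination hMN + M 1 1 * hN - hM * N 0 0

theorem aeval_quadratic_eq_zero {F : Type*} [CommRing F] [Algebra F A]
    {M : Matrix (Fin 2) (Fin 2) A} {t n : F} (ht : M.trace = algebraMap F A t)
    (hn : M.det = algebraMap F A n) : aeval M (X ^ 2 - C t * X + C n : F[X]) = 0 := by
  simp only [map_add, map_sub, map_mul, map_pow, aeval_X, aeval_C, Matrix.algebraMap_eq_diagonal,
    Pi.algebraMap_def]
  rw [pow_two, mul_self_fin_two M, ht, hn]
  ext i j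
  fin_cases i <;> fin_cases j <;> simp [-algebraMap_smul]

variable [IsDomain A]

theorem eq_one_or_neg_one_or_trace_eq_zero {M : Matrix (Fin 2) (Fin 2) A} (h : M * M = 1) :
    M = 1 ∨ M = -1 ∨ M.trace = 0 := by
  by_cases ht : M.trace = 0
  · exact Or.inr (Or.inr ht)
  have h1 : M.trace • M = (1 + M.det) • (1 : Matrix (Fin 2) (Fin 2) A) := by
    have := mul_self_fin_two M
    rw [h] at this
    rw [add_smul, one_smul]
    exact (eq_sub_iff_add_eq.1 this).symm
  have h01 : M 0 1 = 0 := by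
    have := congrFun (congrFun h1 0) 1
    simpa [ht] using this
  have h10 : M 1 0 = 0 := by
    have := congrFun (congrFun h1 1) 0
    simpa [ht] using this
  have h11 : M 1 1 = M 0 0 := by
    have h2 := congrFun (congrFun h1 0) 0
    have h3 := congrFun (congrFun h1 1) 1
    simp only [Matrix.smul_apply, smul_eq_mul, one_apply_eq, mul_one] at h2 h3
    exact mul_left_cancel₀ ht (h3.trans h2.symm)
  have h00 : M 0 0 * M 0 0 = 1 := by
    have := congrFun (congrFun h 0) 0
    simpa [Matrix.mul_apply, Fin.sum_univ_two, h01] using this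
  rcases mul_self_eq_one_iff.1 h00 with h4 | h4
  · left
    ext i j
    fin_cases i <;> fin_cases j <;> simp [h01, h10, h11, h4]
  · right; left
    ext i j
    fin_cases i <;> fin_cases j <;> simp [h01, h10, h11, h4]

theorem eq_or_eq_neg_of_trace_eq_zero (h2 : (2 : A) ≠ 0) {M N : Matrix (Fin 2) (Fin 2) A}
    (hM : M * M = 1) (hN : N * N = 1) (hMN : M * N = N * M) (htM : M.trace = 0)
    (htN : N.trace = 0) : N = M ∨ N = -M := by
  have hsq : (M * N) * (M * N) = 1 := by
    rw [mul_assoc, ← mul_assoc N, ← hMN, mul_assoc M N N, hN, mul_one, hM]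
  have hcancel : M * (M * N) = N := by rw [← mul_assoc, hM, one_mul]
  rcases eq_one_or_neg_one_or_trace_eq_zero hsq with h | h | h
  · left
    rw [h, mul_one] at hcancel
    exact hcancel.symm
  · right
    rw [h, mul_neg, mul_one] at hcancel
    exact hcancel.symm
  · exfalso
    have h3 := mul_add_mul_of_trace_eq_zero htM htN h
    rw [← hMN, ← two_smul A, smul_eq_zero] at h3
    rw [h3.resolve_left h2, mul_zero] at hsq
    exact zero_ne_one hsq

/-- A group of exponent two in `GL₂` of a domain of characteristic other than two has at most four
elements. -/
theorem card_le_four_of_mul_self_eq_one (h2 : (2 : A) ≠ 0) (S : Subgroup (GL (Fin 2) A))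
    (hS : ∀ g ∈ S, g * g = 1) : Nat.card S ≤ 4 := by
  classical
  have hval : ∀ g ∈ S, g.val * g.val = 1 := fun g hg => by
    rw [← Units.val_mul, hS g hg, Units.val_one]
  have hcomm : ∀ g ∈ S, ∀ h ∈ S, g * h = h * g := fun g hg h hh => by
    have h3 := hS _ (S.mul_mem hg hh)
    have h4 : ∀ x ∈ S, x⁻¹ = x := fun x hx => inv_eq_of_mul_eq_one_left (hS x hx)
    have h5 := eq_inv_of_mul_eq_one_left h3
    rwa [_root_.mul_inv_rev, h4 g hg, h4 h hh] at h5
  obtain ⟨M, hM⟩ : ∃ M : Matrix (Fin 2) (Fin 2) A, ∀ g ∈ S,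
      g.val = 1 ∨ g.val = -1 ∨ g.val = M ∨ g.val = -M := by
    by_cases h : ∃ g ∈ S, g.val.trace = 0
    · obtain ⟨g, hg, htg⟩ := h
      refine ⟨g.val, fun h hh => ?_⟩
      rcases eq_one_or_neg_one_or_trace_eq_zero (hval h hh) with h3 | h3 | h3
      · exact Or.inl h3
      · exact Or.inr (Or.inl h3)
      · refine Or.inr (Or.inr ?_)
        refine eq_or_eq_neg_of_trace_eq_zero h2 (hval g hg) (hval h hh) ?_ htg h3
        rw [← Units.val_mul, ← Units.val_mul, hcomm g hg h hh]
    · push Not at h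
      refine ⟨1, fun g hg => ?_⟩
      rcases eq_one_or_neg_one_or_trace_eq_zero (hval g hg) with h3 | h3 | h3
      · exact Or.inl h3
      · exact Or.inr (Or.inl h3)
      · exact absurd h3 (h g hg)
  let T : Finset (Matrix (Fin 2) (Fin 2) A) := {1, -1, M, -M}
  let f : S → T := fun g => ⟨g.1.val, by simpa [T] using hM g.1 g.2⟩
  have hf : Function.Injective f := fun g h hgh =>
    Subtype.ext (Units.ext (congrArg Subtype.val hgh))
  have hle := Nat.card_le_card_of_injective f hf
  rw [Nat.card_eq_fintype_card (α := T), Fintype.card_coe] at hle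
  exact hle.trans Finset.card_le_four

variable {F : Type*} [Field F] [Finite F] [Algebra F A]

/-- A matrix of finite order `m` prime to the characteristic whose eigenvalues lie in the finite
field `F` is diagonalizable, and its order divides `|F| - 1`. -/
theorem pow_gcd_eq_one_of_root {M : Matrix (Fin 2) (Fin 2) A} {t n α : F}
    (ht : M.trace = algebraMap F A t) (hn : M.det = algebraMap F A n)
    (hα : α ^ 2 - t * α + n = 0) {m : ℕ} (hm : m.Coprime (ringChar F)) (hM : M ^ m = 1) :
    M ^ (m.gcd (Nat.card F - 1)) = 1 := by
  set p := ringChar F with hp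
  have hinj : Function.Injective (algebraMap F A) := (algebraMap F A).injective
  have hpp : p.Prime := (CharP.char_is_prime_or_zero F p).resolve_right
    (CharP.char_ne_zero_of_finite F p)
  have hm0 : m ≠ 0 := by
    rintro rfl
    rw [Nat.coprime_zero_left] at hm
    exact hpp.one_lt.ne' hm
  have hn0 : n ≠ 0 := by
    rintro rfl
    rw [map_zero] at hn
    have := congrArg Matrix.det hM
    rw [det_pow, hn, zero_pow hm0, det_one] at this
    exact zero_ne_one this
  have key : ∀ α : F, α ^ 2 - t * α + n = 0 → α ^ (m.gcd (Nat.card F - 1)) = 1 := by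
    intro α hα
    have hα0 : α ≠ 0 := by
      rintro rfl
      exact hn0 (by simpa using hα)
    have hdet : (M - algebraMap F A α • (1 : Matrix (Fin 2) (Fin 2) A)).det = 0 := by
      have h1 := congrArg (algebraMap F A) hα
      rw [map_add, map_sub, map_mul, map_pow, ← ht, ← hn, map_zero, trace_fin_two,
        det_fin_two] at h1
      rw [det_fin_two]
      simp [-algebraMap_smul]
      linear_combination h1
    obtain ⟨v, hv0, hv⟩ := exists_mulVec_eq_zero_iff.2 hdet
    have hMv : M *ᵥ v = algebraMap F A α • v := by
      rwa [sub_mulVec, smul_mulVec, one_mulVec, sub_eq_zero] at hv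
    have hpow : ∀ j : ℕ, (M ^ j) *ᵥ v = (algebraMap F A α) ^ j • v := by
      intro j
      induction j with
      | zero => simp
      | succ j ih => rw [pow_succ, ← mulVec_mulVec, hMv, mulVec_smul, ih, smul_smul, pow_succ']
    obtain ⟨i, hi⟩ := Function.ne_iff.1 hv0
    have h2 := congrFun (hpow m) i
    rw [hM, one_mulVec, Pi.smul_apply, smul_eq_mul] at h2
    have h3 : (algebraMap F A α) ^ m = 1 := mul_right_cancel₀ hi (by rw [one_mul]; exact h2.symm)
    have h4 : α ^ m = 1 := hinj (by rw [map_pow, h3, map_one])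
    have h5 : α ^ (Nat.card F - 1) = 1 := by
      have := Fintype.ofFinite F
      rw [Nat.card_eq_fintype_card]
      exact FiniteField.pow_card_sub_one_eq_one α hα0
    exact pow_gcd_eq_one.2 ⟨h4, h5⟩
  set d := m.gcd (Nat.card F - 1) with hd
  have hα1 := key α hα
  have hβ1 := key (t - α) (by linear_combination hα)
  have hdvd : (X - C α) * (X - C (t - α)) ∣ ((X : F[X]) ^ d - 1) ^ 2 := by
    rw [pow_two]
    refine mul_dvd_mul ?_ ?_ <;> rw [dvd_iff_isRoot] <;> simp [hα1, hβ1]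
  have hzero : aeval M ((X - C α) * (X - C (t - α))) = 0 := by
    have h1 : (X - C α) * (X - C (t - α)) = (X ^ 2 - C t * X + C n : F[X]) := by
      have : C n = C α * C (t - α) := by
        rw [← C_mul]
        congr 1
        linear_combination hα
      rw [this, C_sub]
      ring
    rw [h1]
    exact aeval_quadratic_eq_zero ht hn
  have hsq : (M ^ d - 1) ^ 2 = 0 := by
    obtain ⟨r, hr⟩ := hdvd
    have := congrArg (aeval M) hr
    rw [map_mul, hzero, zero_mul] at this
    simpa using this
  have : Fact p.Prime := ⟨hpp⟩
  have hcA : CharP A p := charP_of_injective_algebraMap hinj p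
  have hcM : CharP (Matrix (Fin 2) (Fin 2) A) p := inferInstance
  have hp1 : (M ^ d) ^ p = 1 := by
    have h1 : (M ^ d - 1) ^ p = (M ^ d) ^ p - 1 ^ p :=
      sub_pow_char_of_commute _ (Commute.one_right _)
    rw [one_pow, ← Nat.sub_add_cancel hpp.two_le, pow_add, hsq, mul_zero,
      Nat.sub_add_cancel hpp.two_le] at h1
    exact sub_eq_zero.1 h1.symm
  have hm1 : (M ^ d) ^ m = 1 := by rw [← pow_mul, mul_comm, pow_mul, hM, one_pow]
  have := pow_gcd_eq_one.2 ⟨hm1, hp1⟩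
  rwa [Nat.coprime_iff_gcd_eq_one.1 hm, pow_one] at this

/-- A finite group of matrices, with characteristic polynomials over `F`, whose order is divisible
by `|F| ^ 2 - 1` contains a matrix without eigenvalues in `F`. Otherwise the elements of order prime
to the characteristic would have orders dividing `|F| - 1`, which is impossible for an element of
odd prime order dividing `|F| + 1`; and if `|F| + 1` is a power of `2`, there would be a subgroup
of order `8` and of exponent two. -/
theorem exists_no_root_of_dvd_card (H : Subgroup (GL (Fin 2) A)) [Finite H]
    (hH : ∀ g ∈ H, ∃ t n : F, g.val.trace = algebraMap F A t ∧ g.val.det = algebraMap F A n)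
    (hdvd : Nat.card F ^ 2 - 1 ∣ Nat.card H) :
    ∃ g ∈ H, ∃ t n : F, g.val.trace = algebraMap F A t ∧ g.val.det = algebraMap F A n ∧
      ∀ u : F, u ^ 2 - t * u + n ≠ 0 := by
  by_contra! hcon
  set p := ringChar F with hp
  have hpp : p.Prime := (CharP.char_is_prime_or_zero F p).resolve_right
    (CharP.char_ne_zero_of_finite F p)
  set q := Nat.card F with hq
  have hq1 : 1 < q := Finite.one_lt_card
  have hpq : p ∣ q := by
    have := Fintype.ofFinite F
    obtain ⟨f, -, hf⟩ := FiniteField.card F p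
    rw [hq, Nat.card_eq_fintype_card, hf]
    exact dvd_pow_self p f.ne_zero
  have hgcd : ∀ g ∈ H, ∀ m : ℕ, m.Coprime p → g ^ m = 1 → g ^ (m.gcd (q - 1)) = 1 := by
    intro g hg m hm hgm
    obtain ⟨t, n, ht, hn⟩ := hH g hg
    obtain ⟨α, hα⟩ := hcon g hg t n ht hn
    refine Units.ext ?_
    rw [Units.val_pow_eq_pow_val, Units.val_one]
    refine pow_gcd_eq_one_of_root ht hn hα hm ?_
    rw [← Units.val_pow_eq_pow_val, hgm, Units.val_one]
  have hfac : q ^ 2 - 1 = (q + 1) * (q - 1) := by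
    rw [← Nat.sq_sub_sq, one_pow]
  have hcop : ∀ l, l.Prime → l ∣ q + 1 → l.Coprime p := fun l hl hlq => by
    rw [Nat.coprime_primes hl hpp]
    intro h
    have : l ∣ 1 := (Nat.dvd_add_right (h ▸ hpq)).1 hlq
    exact hl.one_lt.ne' (Nat.dvd_one.1 this)
  by_cases hodd : ∃ l, l.Prime ∧ l ∣ q + 1 ∧ l ≠ 2
  · obtain ⟨l, hl, hlq, hl2⟩ := hodd
    have : Fact l.Prime := ⟨hl⟩
    have hlH : l ∣ Nat.card H := (hlq.trans (hfac ▸ Dvd.intro _ rfl)).trans hdvd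
    obtain ⟨g, hg⟩ := exists_prime_orderOf_dvd_card' (G := H) l hlH
    have hg1 : (g : GL (Fin 2) A) ^ l = 1 := by
      rw [← hg, ← Subgroup.orderOf_coe]
      exact pow_orderOf_eq_one _
    have h1 := hgcd g g.2 l (hcop l hl hlq) hg1
    have h2 : l.gcd (q - 1) = 1 := by
      rw [← Nat.coprime_iff_gcd_eq_one, hl.coprime_iff_not_dvd]
      intro h
      have : l ∣ 2 := by
        have := Nat.dvd_sub hlq h
        rwa [show q + 1 - (q - 1) = 2 by omega] at this
      exact hl2 ((Nat.prime_dvd_prime_iff_eq hl Nat.prime_two).1 this)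
    rw [h2, pow_one] at h1
    have h3 : g = 1 := Subtype.ext h1
    rw [h3, orderOf_one] at hg
    exact hl.one_lt.ne hg
  · push Not at hodd
    have hpow := Nat.eq_prime_pow_of_unique_prime_dvd (n := q + 1) (p := 2) (by omega)
      (fun {l} hl hlq => hodd l hl hlq)
    set k := (q + 1).primeFactorsList.length with hk
    have hk2 : 2 ≤ k := by
      by_contra hlt
      have : 2 ^ k ≤ 2 ^ 1 := Nat.pow_le_pow_right (by norm_num) (by omega)
      omega
    have h4 : 4 ∣ q + 1 := by
      rw [hpow]
      exact pow_dvd_pow 2 hk2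
    have h8 : 2 ^ 3 ∣ Nat.card H := by
      refine dvd_trans ?_ hdvd
      rw [hfac, show 2 ^ 3 = 4 * 2 by norm_num]
      exact mul_dvd_mul h4 (by omega)
    have : Fact (Nat.Prime 2) := ⟨Nat.prime_two⟩
    obtain ⟨S, hS⟩ := Sylow.exists_subgroup_card_pow_prime (G := H) 2 h8
    have hp2 : Nat.Coprime 2 p := hcop 2 Nat.prime_two ((by norm_num : 2 ∣ 4).trans h4)
    have h2F : (2 : F) ≠ 0 := fun h => by
      have : p ∣ 2 := (ringChar.spec F 2).1 (by exact_mod_cast h)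
      rw [Nat.prime_dvd_prime_iff_eq hpp Nat.prime_two] at this
      rw [this] at hp2
      norm_num at hp2
    have h2A : (2 : A) ≠ 0 := by
      have := (map_ne_zero_iff (algebraMap F A) (algebraMap F A).injective).2 h2F
      rwa [map_ofNat] at this
    have hle := card_le_four_of_mul_self_eq_one h2A (S.map H.subtype) (by
      rintro _ ⟨g, hg, rfl⟩
      have h1 : (g : GL (Fin 2) A) ^ 8 = 1 := by
        have := pow_card_eq_one' (x := (⟨g, hg⟩ : S))
        rw [hS] at this
        exact congrArg (fun x : S => ((x : H) : GL (Fin 2) A)) this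
      have h3 := hgcd g g.2 8 (hp2.pow_left 3) h1
      have h5 : Nat.gcd 8 (q - 1) = 2 := by
        obtain ⟨c, hc⟩ := h4
        obtain ⟨e, rfl⟩ : ∃ e, c = e + 1 := ⟨c - 1, by omega⟩
        have h6 : q - 1 = 2 * (2 * e + 1) := by omega
        rw [h6, show 8 = 2 * 4 by norm_num, Nat.gcd_mul_left]
        have : Nat.gcd 4 (2 * e + 1) = 1 := by
          rw [← Nat.coprime_iff_gcd_eq_one]
          exact Nat.Coprime.pow_left 2 (Nat.coprime_two_left.2 ⟨e, rfl⟩)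
        rw [this]
      rw [h5, pow_two] at h3
      exact h3)
    rw [Subgroup.card_map_of_injective H.subtype_injective, hS] at hle
    norm_num at hle

end FiniteMatrixGroups

end DrinfeldModular

namespace DrinfeldModular

/-! ### The residue field at a place of odd degree -/

namespace Place

open Matrix Polynomial

variable {F K : Type*} [Field F] [Field K] [Algebra F K]

theorem finite_residueField [Finite F] (P : Place F K) (hδ : Odd P.degree) :
    Finite (IsLocalRing.ResidueField P.ring) := by
  have : FiniteDimensional F (IsLocalRing.ResidueField P.ring) :=
    Module.finite_of_finrank_pos hδ.pos
  exact Module.finite_of_finite F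

theorem irreducible_quadratic {t n : F} (h : ∀ u : F, u ^ 2 - t * u + n ≠ 0) :
    Irreducible (X ^ 2 - C t * X + C n : F[X]) := by
  have hdeg : (X ^ 2 - C t * X + C n : F[X]).natDegree = 2 := by compute_degree!
  refine irreducible_of_degree_le_three_of_not_isRoot (by rw [hdeg]; simp) fun u hu => h u ?_
  simpa using hu

/-- A quadratic polynomial without roots in `F` has no roots in the residue field of a place of odd
degree. -/
theorem one_le_val_quadratic (P : Place F K) (hδ : Odd P.degree) {t n : F}
    (h : ∀ u : F, u ^ 2 - t * u + n ≠ 0) {x : K} (hx : P.val x ≤ 1) :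
    1 ≤ P.val (x ^ 2 - algebraMap F K t * x + algebraMap F K n) := by
  by_contra! hlt
  have : FiniteDimensional F (IsLocalRing.ResidueField P.ring) :=
    Module.finite_of_finrank_pos hδ.pos
  let x' : P.ring := ⟨x, hx⟩
  have hmem : x' ^ 2 - algebraMap F P.ring t * x' + algebraMap F P.ring n
      ∈ IsLocalRing.maximalIdeal P.ring := by
    refine (Valuation.mem_maximalIdeal_iff (v := P.val)).2 ?_
    exact hlt
  have hroot : aeval (IsLocalRing.residue P.ring x') (X ^ 2 - C t * X + C n : F[X]) = 0 := by
    have h1 := (IsLocalRing.residue_eq_zero_iff _).2 hmem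
    simp only [map_add, map_sub, map_mul, map_pow] at h1
    simp only [map_add, map_sub, map_mul, map_pow, aeval_X, aeval_C]
    exact h1
  have hdeg : (X ^ 2 - C t * X + C n : F[X]).natDegree = 2 := by compute_degree!
  have hmonic : (X ^ 2 - C t * X + C n : F[X]).Monic := by monicity!
  have hmin := minpoly.eq_of_irreducible_of_monic (irreducible_quadratic h) hroot hmonic
  have hdvd := minpoly.degree_dvd
    (IsIntegral.of_finite F (IsLocalRing.residue P.ring x'))
  rw [← hmin, hdeg] at hdvd
  exact (Nat.not_even_iff_odd.2 hδ) (even_iff_two_dvd.2 hdvd)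

variable [Finite F] (P : Place F K)

theorem absValue_lt_iff (x y : K) : P.absValue x < P.absValue y ↔ P.val x < P.val y := by
  rw [← (WithZeroMulInt.toNNReal_strictMono (one_lt_card (F := F))).lt_iff_lt]
  exact NNReal.coe_lt_coe

theorem absValue_le_iff (x y : K) : P.absValue x ≤ P.absValue y ↔ P.val x ≤ P.val y := by
  rw [← not_lt, absValue_lt_iff, not_lt]

theorem norm_toCompletion_le_one_iff (x : K) : ‖P.toCompletion x‖ ≤ 1 ↔ P.val x ≤ 1 := by
  rw [norm_toCompletion, ← map_one P.absValue, absValue_le_iff, map_one]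

theorem norm_toCompletion_lt_one_iff (x : K) : ‖P.toCompletion x‖ < 1 ↔ P.val x < 1 := by
  rw [norm_toCompletion, ← map_one P.absValue, absValue_lt_iff, map_one]

theorem exists_norm_sub_lt_one (u : P.Completion) : ∃ x : K, ‖u - P.toCompletion x‖ < 1 := by
  obtain ⟨x, hx⟩ := (UniformSpace.Completion.denseRange_coe
    (α := WithAbs P.absValue)).exists_dist_lt u one_pos
  refine ⟨WithAbs.equiv P.absValue x, ?_⟩
  rw [dist_eq_norm] at hx
  exact hx

theorem one_le_norm_quadratic (hδ : Odd P.degree) {t n : F}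
    (h : ∀ u : F, u ^ 2 - t * u + n ≠ 0) {u : P.Completion} (hu : ‖u‖ ≤ 1) :
    1 ≤ ‖u ^ 2 - P.toCompletion (algebraMap F K t) * u + P.toCompletion (algebraMap F K n)‖ := by
  by_contra! hlt
  obtain ⟨x, hx⟩ := P.exists_norm_sub_lt_one u
  have ht : ‖P.toCompletion (algebraMap F K t)‖ ≤ 1 :=
    (P.norm_toCompletion_le_one_iff _).2 (P.algebraMap_mem t)
  have hx1 : ‖P.toCompletion x‖ ≤ 1 := by
    have h1 : P.toCompletion x = u + -(u - P.toCompletion x) := by ring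
    rw [h1]
    exact (IsUltrametricDist.norm_add_le_max _ _).trans
      (max_le hu (by rw [norm_neg]; exact hx.le))
  have h2 : P.toCompletion (x ^ 2 - algebraMap F K t * x + algebraMap F K n)
      = (u ^ 2 - P.toCompletion (algebraMap F K t) * u + P.toCompletion (algebraMap F K n))
        + (u - P.toCompletion x)
          * (P.toCompletion (algebraMap F K t) + -(u + P.toCompletion x)) := by
    simp only [map_add, map_sub, map_mul, map_pow]
    ring
  have h3 : ‖P.toCompletion (algebraMap F K t) + -(u + P.toCompletion x)‖ ≤ 1 := by
    refine (IsUltrametricDist.norm_add_le_max _ _).trans (max_le ht ?_)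
    rw [norm_neg]
    exact (IsUltrametricDist.norm_add_le_max _ _).trans (max_le hu hx1)
  have h4 : ‖P.toCompletion (x ^ 2 - algebraMap F K t * x + algebraMap F K n)‖ < 1 := by
    rw [h2]
    refine (IsUltrametricDist.norm_add_le_max _ _).trans_lt (max_lt hlt ?_)
    rw [norm_mul]
    exact (mul_le_of_le_one_right (norm_nonneg _) h3).trans_lt hx
  exact absurd (P.one_le_val_quadratic hδ h ((P.norm_toCompletion_le_one_iff x).1 hx1))
    (not_le.2 ((P.norm_toCompletion_lt_one_iff _).1 h4))

/-! ### Finiteness of the vertex stabilizers -/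

/-- The constants are integral outside `P`. -/
instance : Algebra F P.integralOutside :=
  ((algebraMap F K).codRestrict P.integralOutside fun a Q _ => Q.algebraMap_mem a).toAlgebra

variable {P}

theorem exists_algebraMap_eq (hK : IsFunctionField F K) {x : P.integralOutside}
    (hx : ‖P.toCompletion x‖ ≤ 1) : ∃ c : F, x = algebraMap F P.integralOutside c := by
  obtain ⟨c, hc⟩ := hK.mem_range_of_val_le_one P x.2 ((P.norm_toCompletion_le_one_iff _).1 hx)
  exact ⟨c, Subtype.ext hc.symm⟩

theorem norm_toCompletion_unit (hK : IsFunctionField F K) (u : P.integralOutsideˣ) :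
    ‖P.toCompletion u.val‖ = 1 := by
  have key : ∀ u : P.integralOutsideˣ, 1 ≤ ‖P.toCompletion u.val‖ := by
    intro u
    by_contra! hlt
    obtain ⟨c, hc⟩ := exists_algebraMap_eq hK hlt.le
    have hc0 : c ≠ 0 := by
      rintro rfl
      rw [map_zero] at hc
      exact u.ne_zero hc
    have h1 : P.val (u.val : K) = 1 := by
      rw [hc]
      exact P.trivial_on_constants c hc0
    rw [norm_toCompletion_lt_one_iff, h1] at hlt
    exact lt_irrefl _ hlt
  refine le_antisymm ?_ (key u)
  have h1 := key u⁻¹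
  have h2 : P.toCompletion u.val * P.toCompletion (u⁻¹).val = 1 := by
    rw [← map_mul, ← Subring.coe_mul, Units.mul_inv, Subring.coe_one, map_one]
  have h3 : ‖P.toCompletion u.val‖ * ‖P.toCompletion (u⁻¹).val‖ = 1 := by
    rw [← norm_mul, h2, norm_one]
  nlinarith [norm_nonneg (P.toCompletion u.val)]

/-- Riemann's finiteness: only finitely many functions have poles of bounded order at `P` and no
other poles. -/
theorem finite_setOf_val_le (hK : IsFunctionField F K) (hδ : Odd P.degree) (m : ℕ) :
    {x : K | x ∈ P.integralOutside ∧ P.val x ≤ WithZero.exp (m : ℤ)}.Finite := by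
  have := P.finite_residueField hδ
  induction m with
  | zero =>
    refine (Set.finite_range (algebraMap F K)).subset ?_
    rintro x ⟨hx, hxP⟩
    exact hK.mem_range_of_val_le_one P hx (by simpa using hxP)
  | succ m ih =>
    classical
    obtain ⟨π, hπ⟩ := P.surjective (WithZero.exp (-((m + 1 : ℕ) : ℤ)))
    have hval : ∀ x, P.val x ≤ WithZero.exp ((m + 1 : ℕ) : ℤ) → P.val (π * x) ≤ 1 := by
      intro x hx
      rw [map_mul, hπ, WithZero.exp_neg]
      exact inv_mul_le_one_of_le₀ hx zero_le
    -- the leading coefficient at `P`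
    let f : K → IsLocalRing.ResidueField P.ring := fun x =>
      if h : P.val (π * x) ≤ 1 then IsLocalRing.residue P.ring ⟨π * x, h⟩ else 0
    refine Set.Finite.of_finite_fibers f (Set.toFinite _) ?_
    rintro _ ⟨y, ⟨hyA, hyP⟩, rfl⟩
    refine (ih.image (· + y)).subset ?_
    rintro x ⟨⟨hxA, hxP⟩, hxy⟩
    refine ⟨x - y, ⟨sub_mem hxA hyA, ?_⟩, sub_add_cancel x y⟩
    have hxy' : f x = f y := hxy
    simp only [f, dif_pos (hval x hxP), dif_pos (hval y hyP)] at hxy'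
    rw [← sub_eq_zero, ← map_sub, IsLocalRing.residue_eq_zero_iff] at hxy'
    have h1 : P.val (π * x - π * y) < 1 := (Valuation.mem_maximalIdeal_iff (v := P.val)).1 hxy'
    rw [← mul_sub, map_mul, hπ, WithZero.exp_neg,
      inv_mul_lt_one₀ (WithZero.exp_pos)] at h1
    rcases eq_or_ne (P.val (x - y)) 0 with h0 | h0
    · rw [h0]
      exact zero_le
    · rw [← WithZero.exp_log h0, WithZero.exp_lt_exp] at h1
      rw [← WithZero.exp_log h0, WithZero.exp_le_exp]
      push_cast at h1
      omega

theorem finite_setOf_norm_le (hK : IsFunctionField F K) (hδ : Odd P.degree) (C : ℝ) :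
    {x : P.integralOutside | ‖P.toCompletion x‖ ≤ C}.Finite := by
  obtain ⟨y, hy⟩ := P.exists_one_lt_absValue
  obtain ⟨j, hj⟩ := pow_unbounded_of_one_lt C hy
  have hy0 : P.val y ≠ 0 := by
    rw [P.val.ne_zero_iff]
    rintro rfl
    rw [map_zero] at hy
    exact not_lt.2 zero_le_one hy
  have hle : P.val (y ^ j) ≤ WithZero.exp (((j * WithZero.log (P.val y)).toNat : ℕ) : ℤ) := by
    rw [map_pow, ← WithZero.exp_log hy0, ← WithZero.exp_nsmul, WithZero.exp_le_exp,
      WithZero.log_exp, nsmul_eq_mul]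
    exact Int.self_le_toNat _
  refine Set.Finite.of_finite_image (f := Subtype.val) ?_ Subtype.val_injective.injOn
  refine (finite_setOf_val_le hK hδ (j * WithZero.log (P.val y)).toNat).subset ?_
  rintro _ ⟨x, hx, rfl⟩
  refine ⟨x.2, le_trans ?_ hle⟩
  rw [← P.absValue_le_iff, map_pow, ← norm_toCompletion]
  exact le_trans hx hj.le

theorem modularEmbedding_apply (g : P.ModularGroup) (i j : Fin 2) :
    (P.modularEmbedding g).val i j = P.toCompletion (g.val i j) := rfl

theorem trace_modularEmbedding (g : P.ModularGroup) :
    (P.modularEmbedding g).val.trace = P.toCompletion g.val.trace := by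
  simp [trace_fin_two, modularEmbedding_apply]

theorem det_modularEmbedding (g : P.ModularGroup) :
    (P.modularEmbedding g).val.det = P.toCompletion g.val.det := by
  simp [det_fin_two, modularEmbedding_apply]

theorem norm_det_modularEmbedding (hK : IsFunctionField F K) (g : P.ModularGroup) :
    ‖(P.modularEmbedding g).val.det‖ = 1 := by
  rw [det_modularEmbedding]
  exact norm_toCompletion_unit hK (Matrix.GeneralLinearGroup.det g)

theorem mem_vertexStabilizer_iff (hK : IsFunctionField F K) (L : PlaneLattice P.Completion)
    (g : P.ModularGroup) : g ∈ P.vertexStabilizer L.toVertex ↔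
      ∀ x, L.toNorm.toFun (x ᵥ* (P.modularEmbedding g).val) = L.toNorm.toFun x :=
  smul_mk_eq_iff_of_norm_det (norm_det_modularEmbedding hK g) L

theorem exists_trace_eq (hK : IsFunctionField F K) {L : PlaneLattice P.Completion}
    {g : P.ModularGroup} (hg : g ∈ P.vertexStabilizer L.toVertex) :
    ∃ t n : F, g.val.trace = algebraMap F P.integralOutside t ∧
      g.val.det = algebraMap F P.integralOutside n := by
  rw [mem_vertexStabilizer_iff hK] at hg
  have ht := norm_trace_le_of_toNorm_le L (P.modularEmbedding g).val (r := 1)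
    (fun x => by rw [hg, one_mul])
  rw [trace_modularEmbedding] at ht
  have hn := norm_det_modularEmbedding hK g
  rw [det_modularEmbedding] at hn
  obtain ⟨t, ht⟩ := exists_algebraMap_eq hK ht
  obtain ⟨n, hn⟩ := exists_algebraMap_eq hK hn.le
  exact ⟨t, n, ht, hn⟩

theorem finite_vertexStabilizer (hK : IsFunctionField F K) (hδ : Odd P.degree)
    (L : PlaneLattice P.Completion) : Finite (P.vertexStabilizer L.toVertex) := by
  obtain ⟨C, hC⟩ := exists_norm_entry_le L
  have := (P.finite_setOf_norm_le hK hδ C).to_subtype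
  let f : P.vertexStabilizer L.toVertex →
      Fin 2 → Fin 2 → {x : P.integralOutside | ‖P.toCompletion x‖ ≤ C} := fun g i j =>
    ⟨g.1.val i j, hC (P.modularEmbedding g.1).val ((mem_vertexStabilizer_iff hK L g.1).1 g.2) i j⟩
  refine Finite.of_injective f fun g h hgh => ?_
  refine Subtype.ext (Units.ext (Matrix.ext fun i j => ?_))
  exact congrArg Subtype.val (congrFun (congrFun hgh i) j)

/-! ### Elliptic points and the order of a vertex stabilizer -/

/-- If `g` has the fixed point `ω` and is not scalar, its eigenvalues do not lie in `F`. -/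
theorem quadratic_ne_zero_of_smul_eq {g : P.ModularGroup} {ω : HalfPlane P.Completion}
    (hg : P.modularEmbedding g • ω = ω) (hns : ¬ ∃ a, g.val = Matrix.scalar (Fin 2) a) {t n : F}
    (ht : g.val.trace = algebraMap F P.integralOutside t)
    (hn : g.val.det = algebraMap F P.integralOutside n) (u : F) : u ^ 2 - t * u + n ≠ 0 := by
  intro hu
  have hinj : Function.Injective (fun x : P.integralOutside => P.toCompletion x) :=
    P.toCompletion.injective.comp Subtype.val_injective
  have hε := HalfPlane.charpoly_denom hg
  rw [trace_modularEmbedding, det_modularEmbedding, ht, hn] at hε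
  let φ : F →+* CompletedClosure P.Completion :=
    (algebraMap P.Completion (CompletedClosure P.Completion)).comp
      (P.toCompletion.comp (algebraMap F K))
  set ε := algebraMap P.Completion (CompletedClosure P.Completion)
      ((P.modularEmbedding g).val 1 0) * ω.1
    + algebraMap P.Completion _ ((P.modularEmbedding g).val 1 1) with hεdef
  have hε' : ε ^ 2 - φ t * ε + φ n = 0 := hε
  have hu' : φ u ^ 2 - φ t * φ u + φ n = 0 := by
    rw [← map_pow, ← map_mul, ← map_sub, ← map_add, hu, map_zero]
  obtain ⟨a, ha⟩ : ∃ a : F, ε = φ a := by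
    have : (ε - φ u) * (ε - φ (t - u)) = 0 := by
      rw [map_sub]
      linear_combination hε' - hu'
    rcases mul_eq_zero.1 this with h | h
    · exact ⟨u, sub_eq_zero.1 h⟩
    · exact ⟨t - u, sub_eq_zero.1 h⟩
  have h1 := ω.eq_zero (u := (P.modularEmbedding g).val 1 0)
    (v := (P.modularEmbedding g).val 1 1 - P.toCompletion (algebraMap F K a)) (by
      have : ε = algebraMap P.Completion _ (P.toCompletion (algebraMap F K a)) := ha
      rw [map_sub, ← this, hεdef]
      ring)
  have h2 := (HalfPlane.smul_eq_iff _ _).1 hg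
  have h3 := ω.eq_zero (u := (P.modularEmbedding g).val 0 0 - (P.modularEmbedding g).val 1 1)
    (v := (P.modularEmbedding g).val 0 1) (by
      rw [h1.1, map_zero] at h2
      rw [map_sub]
      linear_combination h2)
  have h4 : g.val 1 0 = 0 := hinj (h1.1.trans (map_zero P.toCompletion).symm)
  have h5 : g.val 0 1 = 0 := hinj (h3.2.trans (map_zero P.toCompletion).symm)
  have h6 : g.val 0 0 = g.val 1 1 := hinj (sub_eq_zero.1 h3.1)
  refine hns ⟨g.val 0 0, ?_⟩
  ext i j
  fin_cases i <;> fin_cases j <;> simp [h4, h5, h6]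

/-- The polynomials in `g` have `(ω, 1)` as an eigenvector if `g` fixes `ω`. -/
theorem smul_eq_of_val_eq_aeval {g h : P.ModularGroup} {ω : HalfPlane P.Completion}
    (hg : P.modularEmbedding g • ω = ω) {p : F[X]} (hp : h.val = aeval g.val p) :
    P.modularEmbedding h • ω = ω := by
  let φ : P.integralOutside →+* CompletedClosure P.Completion :=
    (algebraMap P.Completion (CompletedClosure P.Completion)).comp
      (P.toCompletion.comp P.integralOutside.subtype)
  let Φ : Matrix (Fin 2) (Fin 2) P.integralOutside →+*
      Matrix (Fin 2) (Fin 2) (CompletedClosure P.Completion) := φ.mapMatrix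
  have hiff : ∀ h : P.ModularGroup, P.modularEmbedding h • ω = ω ↔
      ∃ c : CompletedClosure P.Completion, Φ h.val *ᵥ ![ω.1, 1] = c • ![ω.1, 1] := by
    intro h
    rw [HalfPlane.smul_eq_iff]
    have h0 : (Φ h.val *ᵥ ![ω.1, 1]) 0 = φ (h.val 0 0) * ω.1 + φ (h.val 0 1) := by
      simp [Φ, mulVec, dotProduct, Fin.sum_univ_two]
    have h1 : (Φ h.val *ᵥ ![ω.1, 1]) 1 = φ (h.val 1 0) * ω.1 + φ (h.val 1 1) := by
      simp [Φ, mulVec, dotProduct, Fin.sum_univ_two]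
    constructor
    · intro hh
      refine ⟨φ (h.val 1 0) * ω.1 + φ (h.val 1 1), ?_⟩
      ext i
      fin_cases i
      · exact h0.trans hh
      · refine h1.trans ?_
        simp
    · rintro ⟨c, hc⟩
      rw [hc] at h0 h1
      have h0' : c * ω.1 = φ (h.val 0 0) * ω.1 + φ (h.val 0 1) := h0
      have h1' : c = φ (h.val 1 0) * ω.1 + φ (h.val 1 1) := by
        rw [← h1]
        simp
      rw [h1'] at h0'
      exact h0'.symm
  rw [hiff] at hg ⊢
  obtain ⟨c, hc⟩ := hg
  rw [hp]
  clear hp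
  induction p using Polynomial.induction_on' with
  | add p q hp hq =>
    obtain ⟨a, ha⟩ := hp
    obtain ⟨b, hb⟩ := hq
    exact ⟨a + b, by rw [map_add, map_add, add_mulVec, ha, hb, add_smul]⟩
  | monomial j a =>
    refine ⟨φ (algebraMap F _ a) * c ^ j, ?_⟩
    have hpow : ∀ j : ℕ, (Φ g.val ^ j) *ᵥ ![ω.1, 1] = c ^ j • ![ω.1, 1] := by
      intro j
      induction j with
      | zero => simp
      | succ j ih => rw [pow_succ, ← mulVec_mulVec, hc, mulVec_smul, ih, smul_smul, pow_succ']
    have hconst : Φ (algebraMap F _ a)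
        = φ (algebraMap F _ a) • (1 : Matrix (Fin 2) (Fin 2) (CompletedClosure P.Completion)) := by
      ext i j
      fin_cases i <;> fin_cases j <;> simp [Φ, Matrix.algebraMap_eq_diagonal]
    rw [aeval_monomial, map_mul, map_pow, hconst, smul_mul_assoc, one_mul, smul_mulVec, hpow,
      smul_smul]

/-- An elliptic matrix `g` with fixed point over the vertex generates a field `F[g]` with `q ^ 2`
elements, the unit group of which fixes the vertex. -/
theorem dvd_card_of_isElliptic (hK : IsFunctionField F K) {L : PlaneLattice P.Completion}
    {ω : HalfPlane P.Completion} (hω : P.IsElliptic ω)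
    (hL : buildingMap ω = L.toVertex.toPoint) :
    Nat.card F ^ 2 - 1 ∣ Nat.card (P.vertexStabilizer L.toVertex) := by
  obtain ⟨g, hg, hns⟩ := hω
  have hg' : P.modularEmbedding g • ω = ω := hg
  have hstab : ∀ h : P.ModularGroup, P.modularEmbedding h • ω = ω →
      h ∈ P.vertexStabilizer L.toVertex := fun h hh => smul_mk_eq_of_buildingMap_eq hh hL
  obtain ⟨t, n, ht, hn⟩ := exists_trace_eq hK (hstab g hg')
  have hirr := irreducible_quadratic (quadratic_ne_zero_of_smul_eq hg' hns ht hn)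
  have hzero := aeval_quadratic_eq_zero ht hn
  set χ : F[X] := X ^ 2 - C t * X + C n with hχ
  have hdeg : χ.natDegree = 2 := by rw [hχ]; compute_degree!
  have : Fact (Irreducible χ) := ⟨hirr⟩
  let E := AdjoinRoot χ
  have hcardE : Nat.card E = Nat.card F ^ 2 := by
    have : FiniteDimensional F E := (AdjoinRoot.powerBasis hirr.ne_zero).finite
    rw [Module.natCard_eq_pow_finrank (K := F), (AdjoinRoot.powerBasis hirr.ne_zero).finrank,
      AdjoinRoot.powerBasis_dim, hdeg]
  let ψ : E →+* Matrix (Fin 2) (Fin 2) P.integralOutside :=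
    Ideal.Quotient.lift (Ideal.span {χ}) (aeval g.val : F[X] →ₐ[F] _).toRingHom (by
      intro a ha
      obtain ⟨b, rfl⟩ := Ideal.mem_span_singleton.1 ha
      show aeval g.val (χ * b) = 0
      rw [map_mul, hzero, zero_mul])
  have hψ : ∀ p : F[X], ψ (AdjoinRoot.mk χ p) = aeval g.val p := fun p => rfl
  let f : Eˣ →* P.ModularGroup := Units.map ψ.toMonoidHom
  have hf : ∀ e, f e ∈ P.vertexStabilizer L.toVertex := by
    intro e
    obtain ⟨p, hp⟩ := AdjoinRoot.mk_surjective (e : E)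
    refine hstab _ (smul_eq_of_val_eq_aeval hg' (p := p) ?_)
    show ψ (e : E) = _
    rw [← hp, hψ]
  have hfinj : Function.Injective f := Units.map_injective ψ.injective
  have := Subgroup.card_dvd_of_injective (f.codRestrict _ hf)
    (fun a b hab => hfinj (congrArg Subtype.val hab))
  rwa [Nat.card_units, hcardE] at this

/-- If `q ^ 2 - 1` divides the order of the stabilizer of a vertex, then the stabilizer contains a
matrix without eigenvalues modulo the maximal ideal; the vertex and the image of the fixed point of
this matrix are both fixed by it, hence agree. -/
theorem exists_isElliptic_of_dvd_card (hK : IsFunctionField F K) (hδ : Odd P.degree)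
    {L : PlaneLattice P.Completion}
    (hdvd : Nat.card F ^ 2 - 1 ∣ Nat.card (P.vertexStabilizer L.toVertex)) :
    ∃ ω, P.IsElliptic ω ∧ buildingMap ω = L.toVertex.toPoint := by
  have := finite_vertexStabilizer hK hδ L
  obtain ⟨g, hg, t, n, ht, hn, hroot⟩ := exists_no_root_of_dvd_card (P.vertexStabilizer L.toVertex)
    (fun g hg => exists_trace_eq hK hg) hdvd
  have htr : (P.modularEmbedding g).val.trace = P.toCompletion (algebraMap F K t) := by
    rw [trace_modularEmbedding, ht]
    rfl
  have hdet : (P.modularEmbedding g).val.det = P.toCompletion (algebraMap F K n) := by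
    rw [det_modularEmbedding, hn]
    rfl
  have hnorm := norm_det_modularEmbedding hK g
  have hres : ∀ u : P.Completion, ‖u‖ ≤ 1 → 1 ≤ ‖u ^ 2 - (P.modularEmbedding g).val.trace * u
      + (P.modularEmbedding g).val.det‖ := fun u hu => by
    rw [htr, hdet]
    exact P.one_le_norm_quadratic hδ hroot hu
  have ht1 : ‖(P.modularEmbedding g).val.trace‖ ≤ 1 := by
    rw [htr]
    exact (P.norm_toCompletion_le_one_iff _).2 (P.algebraMap_mem t)
  obtain ⟨ω, hω⟩ := HalfPlane.exists_smul_eq (P.modularEmbedding g) fun u hu => by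
    -- a root would be a unit
    have h1 := hres u (norm_eq_one_of_quadratic hu ht1 hnorm).le
    rw [hu, norm_zero] at h1
    exact not_lt.2 h1 one_pos
  refine ⟨ω, ⟨g, hω, ?_⟩, ?_⟩
  · rintro ⟨a, ha⟩
    have h1 : ‖P.toCompletion a‖ = 1 := by
      refine norm_eq_one_of_quadratic (t := (P.modularEmbedding g).val.trace) ?_ ht1 hnorm
      rw [trace_modularEmbedding, det_modularEmbedding, ha, trace_fin_two, det_fin_two]
      simp
      ring
    have h2 := hres (P.toCompletion a) h1.le
    rw [trace_modularEmbedding, det_modularEmbedding, ha, trace_fin_two, det_fin_two] at h2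
    have h3 : (P.toCompletion a : P.Completion) ^ 2
        - P.toCompletion ((Matrix.scalar (Fin 2) a) 0 0 + (Matrix.scalar (Fin 2) a) 1 1 :
            P.integralOutside) * P.toCompletion a
        + P.toCompletion ((Matrix.scalar (Fin 2) a) 0 0 * (Matrix.scalar (Fin 2) a) 1 1
          - (Matrix.scalar (Fin 2) a) 0 1 * (Matrix.scalar (Fin 2) a) 1 0 : P.integralOutside)
        = 0 := by
      simp
      ring
    rw [h3, norm_zero] at h2
    exact not_lt.2 h2 one_pos
  · have hε := HalfPlane.charpoly_denom hω
    have hε1 := norm_eq_one_of_quadratic hε (by rwa [norm_algebraMap']) (by rwa [norm_algebraMap'])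
    refine Quotient.sound (PlaneNorm.similarity_of_invariant (M := (P.modularEmbedding g).val)
      (fun x => ?_) ((mem_vertexStabilizer_iff hK L g).1 hg) ht1 hres)
    rw [HalfPlane.toNorm_vecMul hω, hε1, one_mul]

end Place

end DrinfeldModular

end

theorem theorem3p7 {F K : Type*} [Field F] [Finite F] [Field K] [Algebra F K]
    (hK : DrinfeldModular.IsFunctionField F K) (P : DrinfeldModular.Place F K)
    (hδ : Odd P.degree) (v : DrinfeldModular.Vertex P.Completion) :
    Finite (P.vertexStabilizer v) ∧
      ((∃ ω : DrinfeldModular.HalfPlane P.Completion,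
          P.IsElliptic ω ∧ DrinfeldModular.buildingMap ω = v.toPoint) ↔
        Nat.card F ^ 2 - 1 ∣ Nat.card (P.vertexStabilizer v)) := by
  obtain ⟨L⟩ := v
  exact ⟨DrinfeldModular.Place.finite_vertexStabilizer hK hδ L,
    fun ⟨_, hω, hL⟩ => DrinfeldModular.Place.dvd_card_of_isElliptic hK hω hL,
    DrinfeldModular.Place.exists_isElliptic_of_dvd_card hK hδ⟩
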